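/- **Conventions.** Write dual objects as $\mathring x=x_r+\epsilon x_c$ with $\epsilon^2=0$ (real part $x_r$, dual part $x_c$; derivatives, limits and $\operatorname{red},\operatorname{aug},\operatorname{sgn}$ act on both parts). Quaternion multiplication $\circ$, conjugation $*$ and the cross product are extended to dual quaternions and dual vectors by bilinearity; $\operatorname{aug}(x)$ is the quaternion with scalar part $0$ and vector part $x\in\mathbb R^3$, and $\operatorname{red}$ is the vector part of a quaternion. Put $\operatorname{crs}(\mathring x,\mathring y)=x_r^\top y_c+x_c^\top y_r$, $\operatorname{exch}(\mathring x)=x_c+\epsilon x_r$, and $$\operatorname{func}(\mathring x,\mathring y,\mathring z)=(\|y_r\times y_c+z_c\|_2+1)\operatorname{sgn}(x_c)+\epsilon(\|y_r\|_2^2+\|z_r\|_2+1)\operatorname{sgn}(x_r),$$ with the componentwise sign. **System.** Let $0=h_0<h_1<\dots<h_s=T<\infty$, $s\ge1$. For each iteration $k=0,1,2,\dots$ let $\mathring Q_k=Q_k+\epsilon\tfrac12Q_k\circ\operatorname{aug}(P_k)$, with $Q_k(t)$ a unit quaternion and $P_k(t)\in\mathbb R^3$, and $\mathring\omega_k=\omega_k+\epsilon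 v_k$ satisfy on $[0,T]$ $$\dot{\mathring Q}_k=\tfrac12\mathring Q_k\circ\operatorname{aug}(\mathring\omega_k),\qquad \mathring M\dot{\mathring\omega}_k=-\mathring\omega_k^\times\mathring M\mathring\omega_k+\mathring f_k+\mathring d_k,\qquad \mathring M\mathring x=m\,x_c+\epsilon Jx_r,$$ where $m>0$ and $J\in\mathbb R^{3\times3}$ is symmetric positive definite. Let the desired motion $\mathring Q_d=Q_d+\epsilon\frac12Q_d\circ\operatorname{aug}(P_d)$, $Q_d(t)$ a unit quaternion, satisfy $\dot{\mathring Q}_d=\frac12\mathring Q_d\circ\operatorname{aug}(\mathring\omega_d)$, with $\mathring\omega_d$ differentiable and $\mathring\omega_d,\dot{\mathring\omega}_d$ bounded on $[0,T]$. Put $\delta\mathring Q_k=\mathring Q_d^*\circ\mathring Q_k$, $\operatorname{tr}(\mathring x)=\operatorname{red}(\delta\mathring Q_k^*\circ\operatorname{aug}(\mathring x)\circ\delta\mathring Q_k)$, $\delta\mathring\omega_k=\mathring\omega_k-\operatorname{tr}(\mathring\omega_d)$, and, with $\delta Q_k=Q_d^*\circ Q_k$ the real part of $\delta\mathring Q_k$,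 $\delta P_k=P_k-\operatorname{red}(\delta Q_k^*\circ\operatorname{aug}(P_d)\circ\delta Q_k)$ and $\delta q_k=\operatorname{red}(\delta Q_k)$. **Assumptions.** (i) For every $k$: $\delta\mathring Q_k(0)=\varsigma_k\mathbf 1+\epsilon\mathbf 0$ with a sign $\varsigma_k\in\{1,-1\}$, and $\delta\mathring\omega_k(0)=0$. (ii) There are (unknown) $\beta_m,\beta_J<\infty$ and functions $\beta_d,\beta_s$ bounded on $[0,T]$ with $m\le\beta_m$, $\|J\|\le\beta_J$ and, writing $\mathring d_k=d_k+\epsilon s_k$, $\|d_k(t)\|\le\beta_d(t)$ and $\|s_k(t)\|\le\beta_s(t)$ for all $k$ and all $t\in[0,T]$. **Learning control.** Let $k_p,k_d,k_c,k_\theta>0$. For $t\in[0,T]$ put $p(t)=\min\{j\in\{1,\dots,s\}:h_j\ge t\}$ and $$\operatorname{proj}(x)(t)=\max\Big\{x(t),\ \sup_{\tau\in(h_{p(t)-1},h_{p(t)}]}x(\tau)-k_c\Big\}.$$ Let $$\mathring f_k=-\hat\theta_k\operatorname{func}\big(\delta\mathring\omega_k,\operatorname{tr}(\mathring\omega_d),\operatorname{tr}(\dot{\mathring\omega}_d)\big)-k_d\operatorname{exch}(\delta\mathring\omega_k)-\epsilon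 k_p\operatorname{red}\big((\delta\mathring Q_k)_r\big)-k_p\operatorname{red}\big((\delta\mathring Q_k^*)_r\circ(\delta\mathring Q_k)_c\big)$$ for $k\ge0$, with $\hat\theta_0=0$ and $$\hat\theta_k-\operatorname{proj}(\hat\theta_{k-1})=k_\theta\operatorname{crs}\big(\delta\mathring\omega_k,\operatorname{func}(\delta\mathring\omega_k,\operatorname{tr}(\mathring\omega_d),\operatorname{tr}(\dot{\mathring\omega}_d))\big),\qquad k\ge1.$$ As the control law is discontinuous, each $\mathring\omega_k$ is an absolutely continuous function that satisfies its equation at almost every $t\in[0,T]$, and the sign of a vanishing component in $\mathring f_k(t)$ may take any value in $[-1,1]$ (which includes the convention $\operatorname{sgn}(0)=0$). **Theorem 1.** For all such motions the following holds. (a1) Perfect tracking: for every $t\in[0,T]$, as $k\to\infty$, $\varsigma_k\,\delta\mathring Q_k(t)\to\mathbf 1+\epsilon\mathbf 0$ and $\varsigma_k\mathring Q_k(t)\to\mathring Q_d(t)$, and $\|\delta P_k(t)\|_2\to0$, $\|\delta q_k(t)\|_2\to0$. In particular, if $\varsigma_k=1$ for all $k$, then $\delta\mathring Q_k(t)\to\mathbf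 1+\epsilon\mathbf 0$ and $\mathring Q_k(t)\to\mathring Q_d(t)$. (a2) Boundedness: the real and dual parts of $\mathring f_k(t)$, $\delta\mathring Q_k(t)$, $\delta\mathring\omega_k(t)$ and the estimates $\hat\theta_k(t)$ are bounded uniformly in $k\in\{0,1,2,\dots\}$ and $t\in[0,T]$. -/

import Mathlib

open Set Filter Topology MeasureTheory
open scoped Quaternion

noncomputable section

namespace DualILC

/-- Euclidean three-space. -/
abbrev Vec3 := EuclideanSpace ℝ (Fin 3)

/-- Dual three-vectors `x_r + ε x_c`; `TrivSqZeroExt.fst` is the real part and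
`TrivSqZeroExt.snd` is the dual part. -/
abbrev DualVec3 := DualNumber Vec3

/-- Dual quaternions `Q_r + ε Q_c`, with the multiplication of the dual numbers over `ℍ`:
`(a + ε b) * (c + ε d) = a c + ε (a d + b c)`. -/
abbrev DualQuat := DualNumber ℍ[ℝ]

/-- The dual object `a + ε b`. -/
def dual {V : Type*} [AddMonoid V] (a b : V) : DualNumber V :=
  TrivSqZeroExt.inl a + TrivSqZeroExt.inr b

/-- `f` has derivative `f'` at `t` within `s`, for the real part and for the dual part. -/
def HasDualDerivWithinAt {V : Type*} [NormedAddCommGroup V] [NormedSpace ℝ V]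
    (f : ℝ → DualNumber V) (f' : DualNumber V) (s : Set ℝ) (t : ℝ) : Prop :=
  HasDerivWithinAt (fun τ => (f τ).fst) f'.fst s t ∧
    HasDerivWithinAt (fun τ => (f τ).snd) f'.snd s t

/-- Both parts of `f` are absolutely continuous on `[0, T]`. -/
def DualAbsolutelyContinuous {V : Type*} [NormedAddCommGroup V]
    (f : ℝ → DualNumber V) (T : ℝ) : Prop :=
  AbsolutelyContinuousOnInterval (fun τ => (f τ).fst) 0 T ∧
    AbsolutelyContinuousOnInterval (fun τ => (f τ).snd) 0 T

/-! ### Vector and quaternion operators -/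

/-- The cross product `x^× y`. -/
def cross (x y : Vec3) : Vec3 := WithLp.toLp 2 (crossProduct x.ofLp y.ofLp)

/-- The pure quaternion with vector part `x`. -/
def aug (x : Vec3) : ℍ[ℝ] := ⟨0, x 0, x 1, x 2⟩

/-- The vector part of a quaternion. -/
def red (q : ℍ[ℝ]) : Vec3 := !₂[q.imI, q.imJ, q.imK]

/-- The componentwise sign, with `sgn 0 = 0`. -/
def sgn (x : Vec3) : Vec3 := WithLp.toLp 2 (fun i => Real.sign (x i))

/-- `u` is a value of the componentwise set-valued sign at `x`: the component `u i` is the sign of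
`x i` where `x i ≠ 0`, and lies in `[-1, 1]` where `x i = 0`. -/
def IsSgnValue (u x : Vec3) : Prop :=
  ∀ i, (0 < x i → u i = 1) ∧ (x i < 0 → u i = -1) ∧ |u i| ≤ 1

/-! ### Their dual versions -/

def dualCross (x y : DualVec3) : DualVec3 :=
  dual (cross x.fst y.fst) (cross x.fst y.snd + cross x.snd y.fst)

def dualAug (x : DualVec3) : DualQuat := dual (aug x.fst) (aug x.snd)

def dualRed (q : DualQuat) : DualVec3 := dual (red q.fst) (red q.snd)

def dualConj (q : DualQuat) : DualQuat := dual (star q.fst) (star q.snd)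

def dualSgn (x : DualVec3) : DualVec3 := dual (sgn x.fst) (sgn x.snd)

def IsDualSgnValue (u x : DualVec3) : Prop :=
  IsSgnValue u.fst x.fst ∧ IsSgnValue u.snd x.snd

/-- `crs (x, y) = x_rᵀ y_c + x_cᵀ y_r`. -/
def crs (x y : DualVec3) : ℝ := inner ℝ x.fst y.snd + inner ℝ x.snd y.fst

/-- `exch (x_r + ε x_c) = x_c + ε x_r`. -/
def exch (x : DualVec3) : DualVec3 := dual x.snd x.fst

/-- The single-valued sign is one of the values of the set-valued sign. -/
theorem isDualSgnValue_dualSgn (x : DualVec3) : IsDualSgnValue (dualSgn x) x := by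
  have key : ∀ y : Vec3, IsSgnValue (sgn y) y := by
    intro y i
    refine ⟨fun hy => ?_, fun hy => ?_, ?_⟩
    · simp [sgn, Real.sign_of_pos hy]
    · simp [sgn, Real.sign_of_neg hy]
    · rcases Real.sign_apply_eq (y i) with hy | hy | hy <;> simp [sgn, hy]
  simpa [IsDualSgnValue, dualSgn, dual] using ⟨key x.fst, key x.snd⟩

/-! ### Rigid-body motion -/

/-- The dual quaternion `Q + ε ½ Q ∘ aug P` of the attitude `Q` and the position `P`. -/
def pose (Q : ℍ[ℝ]) (P : Vec3) : DualQuat := dual Q ((1 / 2 : ℝ) • (Q * aug P))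

/-- The dual inertia operator `M = m I₃ d/dε + ε J`. -/
def inertia (m : ℝ) (J : Matrix (Fin 3) (Fin 3) ℝ) (x : DualVec3) : DualVec3 :=
  dual (m • x.snd) (Matrix.toEuclideanCLM (𝕜 := ℝ) J x.fst)

/-- The kinematics `Q̊' = ½ Q̊ ∘ aug ω̊` on `[0, T]`. -/
def Kinematics (T : ℝ) (X : ℝ → DualQuat) (ω : ℝ → DualVec3) : Prop :=
  ∀ t ∈ Icc 0 T, HasDualDerivWithinAt X ((1 / 2 : ℝ) • (X t * dualAug (ω t))) (Icc 0 T) t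

/-- The dynamics `M ω̊' = -ω̊^× M ω̊ + f̊ + d̊` on `[0, T]`, in the Carathéodory sense: `ω̊` is
absolutely continuous and the equation holds at almost every time. -/
def Dynamics (T m : ℝ) (J : Matrix (Fin 3) (Fin 3) ℝ) (ω f d : ℝ → DualVec3) : Prop :=
  DualAbsolutelyContinuous ω T ∧
    ∀ᵐ t ∂(volume.restrict (Icc 0 T)), ∃ w : DualVec3,
      HasDualDerivWithinAt ω w (Icc 0 T) t ∧
        inertia m J w = -dualCross (ω t) (inertia m J (ω t)) + f t + d t

/-! ### Tracking errors -/

/-- `δQ̊ = Q̊_d^* ∘ Q̊`. -/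
def poseError (Xd X : DualQuat) : DualQuat := dualConj Xd * X

/-- `δP = P - red (δQ^* ∘ aug P_d ∘ δQ)` with `δQ = Q_d^* ∘ Q`. -/
def positionError (Qd : ℍ[ℝ]) (Pd : Vec3) (Q : ℍ[ℝ]) (P : Vec3) : Vec3 :=
  P - red (star (star Qd * Q) * aug Pd * (star Qd * Q))

/-- `tr (x) = red (δQ̊^* ∘ aug x ∘ δQ̊)`. -/
def tr (δQ : DualQuat) (x : DualVec3) : DualVec3 := dualRed (dualConj δQ * dualAug x * δQ)

/-- `δω̊ = ω̊ - tr ω̊_d`. -/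
def velocityError (δQ : DualQuat) (ωd ω : DualVec3) : DualVec3 := ω - tr δQ ωd

/-! ### Controller and learning law -/

/-- The function `func (x, y, z)`, as a function of a value `u` of the sign at `x`. -/
def funcOfSgn (u y z : DualVec3) : DualVec3 :=
  dual ((‖cross y.fst y.snd + z.snd‖ + 1) • u.snd)
    ((‖y.fst‖ ^ 2 + ‖z.fst‖ + 1) • u.fst)

def func (x y z : DualVec3) : DualVec3 := funcOfSgn (dualSgn x) y z

/-- The control law; `u` is the value that is taken for the sign of `δω̊`. -/
def control (kp kd θhat : ℝ) (δQ : DualQuat) (δω u ωd ωd' : DualVec3) : DualVec3 :=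
  -(θhat • funcOfSgn u (tr δQ ωd) (tr δQ ωd')) - kd • exch δω
    - kp • dual 0 (red δQ.fst)
    - kp • dual (red ((dualConj δQ).fst * δQ.snd)) 0

/-- `p(t) = min {j ∈ {1, …, s} : h_j ≥ t}`. -/
def segIndex (s : ℕ) (h : ℕ → ℝ) (t : ℝ) : ℕ := sInf {j : ℕ | 1 ≤ j ∧ j ≤ s ∧ t ≤ h j}

/-- The segment-based dynamic projection of width `kc`. -/
def proj (s : ℕ) (h : ℕ → ℝ) (kc : ℝ) (x : ℝ → ℝ) (t : ℝ) : ℝ :=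
  if sSup (x '' Ioc (h (segIndex s h t - 1)) (h (segIndex s h t))) - kc < x t then x t
  else sSup (x '' Ioc (h (segIndex s h t - 1)) (h (segIndex s h t))) - kc

/-- The increment `kθ crs (δω̊, func (δω̊, tr ω̊_d, tr ω̊_d'))` of the learning law. -/
def learningIncrement (kθ : ℝ) (δQ : DualQuat) (δω ωd ωd' : DualVec3) : ℝ :=
  kθ * crs δω (func δω (tr δQ ωd) (tr δQ ωd'))

end DualILC

end

open DualILC

namespace DualILC

/-! ### Components of dual objects -/

section Components

variable {V : Type*} [AddMonoid V]

@[simp] theorem fst_dual (a b : V) : (dual a b).fst = a := by simp [dual]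

@[simp] theorem snd_dual (a b : V) : (dual a b).snd = b := by simp [dual]

end Components

theorem fst_tr (D : DualQuat) (x : DualVec3) :
    (tr D x).fst = red (star D.fst * aug x.fst * D.fst) := by
  simp [tr, dualRed, dualConj, dualAug]

theorem snd_tr (D : DualQuat) (x : DualVec3) :
    (tr D x).snd = red (star D.fst * aug x.fst * D.snd +
      (star D.fst * aug x.snd + star D.snd * aug x.fst) * D.fst) := by
  simp [tr, dualRed, dualConj, dualAug, add_mul]

theorem fst_dualCross (x y : DualVec3) : (dualCross x y).fst = cross x.fst y.fst := by
  simp [dualCross]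

theorem snd_dualCross (x y : DualVec3) :
    (dualCross x y).snd = cross x.fst y.snd + cross x.snd y.fst := by
  simp [dualCross]

/-! ### Pure quaternions and the cross product -/

instance : StarModule ℝ ℍ[ℝ] := ⟨fun c q => by ext <;> simp⟩

@[simp] theorem aug_re (x : Vec3) : (aug x).re = 0 := rfl
@[simp] theorem aug_imI (x : Vec3) : (aug x).imI = x 0 := rfl
@[simp] theorem aug_imJ (x : Vec3) : (aug x).imJ = x 1 := rfl
@[simp] theorem aug_imK (x : Vec3) : (aug x).imK = x 2 := rfl

@[simp] theorem red_zero_apply (q : ℍ[ℝ]) : red q 0 = q.imI := rfl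
@[simp] theorem red_one_apply (q : ℍ[ℝ]) : red q 1 = q.imJ := rfl
@[simp] theorem red_two_apply (q : ℍ[ℝ]) : red q 2 = q.imK := rfl

@[simp] theorem red_aug (x : Vec3) : red (aug x) = x := by
  ext i; fin_cases i <;> rfl

theorem aug_red_of_star_eq_neg {q : ℍ[ℝ]} (hq : star q = -q) : aug (red q) = q := by
  have h := congrArg QuaternionAlgebra.re hq
  simp only [Quaternion.re_star, Quaternion.re_neg] at h
  ext <;> simp; linarith

@[simp] theorem star_aug (x : Vec3) : star (aug x) = -aug x := by
  ext <;> simp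

@[simp] theorem aug_add (x y : Vec3) : aug (x + y) = aug x + aug y := by
  ext <;> simp

@[simp] theorem aug_sub (x y : Vec3) : aug (x - y) = aug x - aug y := by
  ext <;> simp

/-- The vector part as a continuous linear map. -/
noncomputable def redL : ℍ[ℝ] →L[ℝ] Vec3 :=
  LinearMap.toContinuousLinearMap
    { toFun := red
      map_add' := fun a b => by ext i; fin_cases i <;> simp
      map_smul' := fun c a => by ext i; fin_cases i <;> simp }

/-- The embedding of vectors as pure quaternions, as a continuous linear map. -/
noncomputable def augL : Vec3 →L[ℝ] ℍ[ℝ] :=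
  LinearMap.toContinuousLinearMap
    { toFun := aug
      map_add' := aug_add
      map_smul' := fun c a => by ext <;> simp }

@[simp] theorem redL_apply (q : ℍ[ℝ]) : redL q = red q := rfl

theorem inner_quaternion_eq (a b : ℍ[ℝ]) :
    inner ℝ a b = a.re * b.re + a.imI * b.imI + a.imJ * b.imJ + a.imK * b.imK := by
  rw [Quaternion.inner_def]; simp

theorem inner_vec3_eq (x y : Vec3) :
    inner ℝ x y = x 0 * y 0 + x 1 * y 1 + x 2 * y 2 := by
  simp [PiLp.inner_apply, Fin.sum_univ_three]; ring

theorem inner_aug_right (q : ℍ[ℝ]) (x : Vec3) : inner ℝ q (aug x) = inner ℝ (red q) x := by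
  rw [inner_quaternion_eq, inner_vec3_eq]; simp

@[simp] theorem norm_aug (x : Vec3) : ‖aug x‖ = ‖x‖ := by
  have h : ‖aug x‖ ^ 2 = ‖x‖ ^ 2 := by
    rw [← real_inner_self_eq_norm_sq, ← real_inner_self_eq_norm_sq, inner_aug_right, red_aug]
  exact (sq_eq_sq₀ (norm_nonneg _) (norm_nonneg _)).1 h

theorem norm_red_le (q : ℍ[ℝ]) : ‖red q‖ ≤ ‖q‖ := by
  refine le_of_sq_le_sq ?_ (norm_nonneg _)
  rw [← real_inner_self_eq_norm_sq, ← real_inner_self_eq_norm_sq, inner_quaternion_eq,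
    inner_vec3_eq]
  simp only [red_zero_apply, red_one_apply, red_two_apply]
  nlinarith [mul_self_nonneg q.re]

@[simp] theorem cross_zero_apply (x y : Vec3) : cross x y 0 = x 1 * y 2 - x 2 * y 1 := by
  simp [cross, crossProduct]
@[simp] theorem cross_one_apply (x y : Vec3) : cross x y 1 = x 2 * y 0 - x 0 * y 2 := by
  simp [cross, crossProduct]
@[simp] theorem cross_two_apply (x y : Vec3) : cross x y 2 = x 0 * y 1 - x 1 * y 0 := by
  simp [cross, crossProduct]

theorem aug_mul_aug_sub (x y : Vec3) :
    aug x * aug y - aug y * aug x = (2 : ℝ) • aug (cross x y) := by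
  ext <;> simp <;> ring

theorem norm_cross_le (x y : Vec3) : ‖cross x y‖ ≤ ‖x‖ * ‖y‖ := by
  have h := norm_sub_le (aug x * aug y) (aug y * aug x)
  rw [aug_mul_aug_sub, norm_smul] at h
  simp only [norm_mul, norm_aug, Real.norm_ofNat] at h
  linarith [mul_comm ‖x‖ ‖y‖]

theorem inner_cross_cancel (x y a b : Vec3) :
    inner ℝ x (-cross (x + y) (a + b)) + inner ℝ a (cross x y) = -inner ℝ x (cross y b) := by
  simp only [inner_vec3_eq, PiLp.neg_apply, PiLp.add_apply, cross_zero_apply, cross_one_apply,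
    cross_two_apply]
  ring

theorem inner_cross_cancel_dual (x y v b : Vec3) :
    inner ℝ v (-cross (x + y) (v + b)) + inner ℝ v (cross x b + cross v y) =
      -inner ℝ v (cross y b) := by
  simp only [inner_vec3_eq, PiLp.neg_apply, PiLp.add_apply, cross_zero_apply, cross_one_apply,
    cross_two_apply]
  ring

theorem cross_self_smul (m : ℝ) (v : Vec3) : cross v (m • v) = 0 := by
  ext i; fin_cases i <;> simp <;> ring

theorem cross_smul (m : ℝ) (x v : Vec3) : cross x (m • v) = m • cross x v := by
  ext i; fin_cases i <;> simp <;> ring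

theorem norm_mul_star_self_eq_one {q : ℍ[ℝ]} (hq : q * star q = 1) : ‖q‖ = 1 := by
  have h := congrArg norm hq
  rw [norm_mul, Quaternion.norm_star, norm_one] at h
  nlinarith [norm_nonneg q]

theorem star_mul_self_of_mul_star_self {q : ℍ[ℝ]} (hq : q * star q = 1) : star q * q = 1 :=
  mul_eq_one_comm.1 hq

/-! ### Unit dual quaternions -/

/-- Unit dual quaternions: `q q^* = 1`, written out for the real and the dual part. -/
def IsUnitDual (q : DualQuat) : Prop :=
  q.fst * star q.fst = 1 ∧ q.fst * star q.snd + q.snd * star q.fst = 0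

theorem isUnitDual_pose {Q : ℍ[ℝ]} (hQ : Q * star Q = 1) (P : Vec3) : IsUnitDual (pose Q P) := by
  refine ⟨by simpa [pose] using hQ, ?_⟩
  simp [pose, mul_assoc]

namespace IsUnitDual

variable {p q : DualQuat}

theorem star_mul_fst (hq : IsUnitDual q) : star q.fst * q.fst = 1 :=
  star_mul_self_of_mul_star_self hq.1

theorem star_mul_snd (hq : IsUnitDual q) : star q.fst * q.snd + star q.snd * q.fst = 0 := by
  have h := congrArg (fun x => star q.fst * x * q.fst) hq.2
  simp only [mul_add, add_mul, mul_zero, zero_mul] at h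
  have e : star q.fst * (q.fst * star q.snd) * q.fst + star q.fst * (q.snd * star q.fst) * q.fst
      = (star q.fst * q.fst) * star q.snd * q.fst + star q.fst * q.snd * (star q.fst * q.fst) := by
    noncomm_ring
  rw [e, hq.star_mul_fst] at h
  rw [add_comm]; simpa using h

theorem poseError (hp : IsUnitDual p) (hq : IsUnitDual q) : IsUnitDual (poseError p q) := by
  have h1 : (DualILC.poseError p q).fst = star p.fst * q.fst := by
    simp [DualILC.poseError, dualConj]
  have h2 : (DualILC.poseError p q).snd = star p.fst * q.snd + star p.snd * q.fst := by
    simp [DualILC.poseError, dualConj]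
  refine ⟨?_, ?_⟩
  · rw [h1, star_mul, star_star]
    have e : star p.fst * q.fst * (star q.fst * p.fst)
      = star p.fst * (q.fst * star q.fst) * p.fst := by noncomm_ring
    rw [e, hq.1, mul_one, hp.star_mul_fst]
  · rw [h1, h2, star_add, star_mul, star_mul, star_mul, star_star, star_star]
    have e : star p.fst * q.fst * (star q.snd * p.fst + star q.fst * p.snd) +
        (star p.fst * q.snd + star p.snd * q.fst) * (star q.fst * p.fst)
      = star p.fst * (q.fst * star q.snd + q.snd * star q.fst) * p.fst +
        (star p.fst * (q.fst * star q.fst) * p.snd + star p.snd * (q.fst * star q.fst) * p.fst) := by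
      noncomm_ring
    rw [e, hq.1, hq.2, mul_one, mul_one, hp.star_mul_snd]; simp

theorem norm_fst (hq : IsUnitDual q) : ‖q.fst‖ = 1 := norm_mul_star_self_eq_one hq.1

theorem aug_fst_tr (x : DualVec3) :
    aug (tr q x).fst = star q.fst * aug x.fst * q.fst := by
  rw [fst_tr]
  apply aug_red_of_star_eq_neg
  simp [mul_assoc]

theorem aug_snd_tr (x : DualVec3) :
    aug (tr q x).snd = star q.fst * aug x.fst * q.snd +
      (star q.fst * aug x.snd + star q.snd * aug x.fst) * q.fst := by
  rw [snd_tr]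
  apply aug_red_of_star_eq_neg
  simp [add_mul, mul_assoc]
  abel

theorem norm_fst_tr (hq : IsUnitDual q) (x : DualVec3) : ‖(tr q x).fst‖ = ‖x.fst‖ := by
  rw [← norm_aug, aug_fst_tr]; simp [hq.norm_fst]

theorem norm_snd_tr_le (hq : IsUnitDual q) (x : DualVec3) :
    ‖(tr q x).snd‖ ≤ ‖x.snd‖ + 2 * ‖q.snd‖ * ‖x.fst‖ := by
  rw [← norm_aug, aug_snd_tr]
  have h1 := norm_add_le (star q.fst * aug x.fst * q.snd)
    ((star q.fst * aug x.snd + star q.snd * aug x.fst) * q.fst)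
  have h2 := norm_add_le (star q.fst * aug x.snd) (star q.snd * aug x.fst)
  simp only [norm_mul, Quaternion.norm_star, hq.norm_fst, norm_aug, one_mul, mul_one] at h1 h2
  linarith [mul_comm ‖q.snd‖ ‖x.fst‖]

end IsUnitDual

end DualILC

namespace DualILC

/-! ### Error kinematics -/

theorem Kinematics.poseError {T : ℝ} {Xd X : ℝ → DualQuat} {ωd ω : ℝ → DualVec3}
    (hd : Kinematics T Xd ωd) (h : Kinematics T X ω)
    (hXd : ∀ t ∈ Icc 0 T, IsUnitDual (Xd t)) (hX : ∀ t ∈ Icc 0 T, IsUnitDual (X t)) :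
    Kinematics T (fun t => poseError (Xd t) (X t))
      (fun t => velocityError (DualILC.poseError (Xd t) (X t)) (ωd t) (ω t)) := by
  intro t ht
  obtain ⟨hd1, hd2⟩ := hd t ht
  obtain ⟨h1, h2⟩ := h t ht
  have hu := (hXd t ht).poseError (hX t ht)
  set D := DualILC.poseError (Xd t) (X t) with hD
  have hf : ∀ τ, (DualILC.poseError (Xd τ) (X τ)).fst = star (Xd τ).fst * (X τ).fst := fun τ => by
    simp [DualILC.poseError, dualConj]
  have hs : ∀ τ, (DualILC.poseError (Xd τ) (X τ)).snd =
      star (Xd τ).fst * (X τ).snd + star (Xd τ).snd * (X τ).fst := fun τ => by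
    simp [DualILC.poseError, dualConj]
  have hDf : D.fst = star (Xd t).fst * (X t).fst := hf t
  have hDs : D.snd = star (Xd t).fst * (X t).snd + star (Xd t).snd * (X t).fst := hs t
  have hW1 : aug (velocityError D (ωd t) (ω t)).fst =
      aug (ω t).fst - star D.fst * aug (ωd t).fst * D.fst := by
    simp [velocityError, IsUnitDual.aug_fst_tr]
  have hW2 : aug (velocityError D (ωd t) (ω t)).snd =
      aug (ω t).snd - (star D.fst * aug (ωd t).fst * D.snd +
      (star D.fst * aug (ωd t).snd + star D.snd * aug (ωd t).fst) * D.fst) := by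
    simp [velocityError, IsUnitDual.aug_snd_tr]
  have e1 : D.fst * aug (velocityError D (ωd t) (ω t)).fst =
      D.fst * aug (ω t).fst - aug (ωd t).fst * D.fst := by
    rw [hW1, mul_sub, ← mul_assoc, ← mul_assoc, hu.1, one_mul]
  have e2 : D.fst * aug (velocityError D (ωd t) (ω t)).snd +
      D.snd * aug (velocityError D (ωd t) (ω t)).fst =
      D.fst * aug (ω t).snd + D.snd * aug (ω t).fst
        - aug (ωd t).fst * D.snd - aug (ωd t).snd * D.fst := by
    have e : D.fst * aug (velocityError D (ωd t) (ω t)).snd +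
        D.snd * aug (velocityError D (ωd t) (ω t)).fst =
      D.fst * aug (ω t).snd + D.snd * aug (ω t).fst
        - (D.fst * star D.fst) * aug (ωd t).fst * D.snd
        - (D.fst * star D.fst) * aug (ωd t).snd * D.fst
        - (D.fst * star D.snd + D.snd * star D.fst) * aug (ωd t).fst * D.fst := by
      rw [hW1, hW2]; noncomm_ring
    rw [e, hu.1, hu.2]; simp
  refine ⟨?_, ?_⟩
  · have key := hd1.star.mul h1
    refine (key.congr_deriv ?_).congr_of_mem (fun τ _ => hf τ) ht
    simp only [TrivSqZeroExt.fst_smul, TrivSqZeroExt.fst_mul, dualAug, fst_dual]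
    rw [e1, hDf]
    simp [mul_assoc, smul_sub]
    abel
  · have key := (hd1.star.mul h2).add (hd2.star.mul h1)
    refine (key.congr_deriv ?_).congr_of_mem (fun τ _ => hs τ) ht
    simp only [TrivSqZeroExt.snd_smul, TrivSqZeroExt.fst_smul, TrivSqZeroExt.fst_mul,
      TrivSqZeroExt.snd_mul, dualAug, fst_dual, snd_dual, smul_eq_mul,
      MulOpposite.smul_eq_mul_unop, MulOpposite.unop_op]
    rw [e2, hDf, hDs]
    simp [mul_assoc, mul_add, add_mul, smul_sub]
    abel

section

variable {T : ℝ} {D : ℝ → DualQuat} {W : ℝ → DualVec3}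

theorem Kinematics.hasDerivWithinAt_fst (h : Kinematics T D W) {t : ℝ} (ht : t ∈ Icc 0 T) :
    HasDerivWithinAt (fun τ => (D τ).fst) ((1 / 2 : ℝ) • ((D t).fst * aug (W t).fst))
      (Icc 0 T) t := by
  simpa [dualAug] using (h t ht).1

theorem Kinematics.hasDerivWithinAt_snd (h : Kinematics T D W) {t : ℝ} (ht : t ∈ Icc 0 T) :
    HasDerivWithinAt (fun τ => (D τ).snd)
      ((1 / 2 : ℝ) • ((D t).fst * aug (W t).snd + (D t).snd * aug (W t).fst)) (Icc 0 T) t := by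
  simpa [dualAug] using (h t ht).2

theorem Kinematics.hasDerivWithinAt_snd_mul_star_fst (h : Kinematics T D W) {t : ℝ}
    (ht : t ∈ Icc 0 T) :
    HasDerivWithinAt (fun τ => (D τ).snd * star (D τ).fst)
      ((1 / 2 : ℝ) • ((D t).fst * aug (W t).snd * star (D t).fst)) (Icc 0 T) t := by
  refine ((h.hasDerivWithinAt_snd ht).mul (h.hasDerivWithinAt_fst ht).star).congr_deriv ?_
  simp [mul_assoc, add_mul]

/-- The rate of change of a transported dual vector in the moving frame. -/
theorem Kinematics.hasDualDerivWithinAt_tr (h : Kinematics T D W) {x : ℝ → DualVec3}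
    {x' : DualVec3} {t : ℝ} (ht : t ∈ Icc 0 T)
    (hx : HasDualDerivWithinAt x x' (Icc 0 T) t) :
    HasDualDerivWithinAt (fun τ => tr (D τ) (x τ))
      (tr (D t) x' - dualCross (W t) (tr (D t) (x t))) (Icc 0 T) t := by
  have hr := h.hasDerivWithinAt_fst ht
  have hc := h.hasDerivWithinAt_snd ht
  have h1 : HasDerivWithinAt (fun τ => aug (x τ).fst) (aug x'.fst) (Icc 0 T) t :=
    augL.hasFDerivAt.comp_hasDerivWithinAt t hx.1
  have h2 : HasDerivWithinAt (fun τ => aug (x τ).snd) (aug x'.snd) (Icc 0 T) t :=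
    augL.hasFDerivAt.comp_hasDerivWithinAt t hx.2
  have cr : ∀ a b : Vec3, aug (cross a b) = (1 / 2 : ℝ) • (aug a * aug b - aug b * aug a) := by
    intro a b; rw [aug_mul_aug_sub]; simp
  refine ⟨?_, ?_⟩
  · have key := redL.hasFDerivAt.comp_hasDerivWithinAt t ((hr.star.mul h1).mul hr)
    refine (key.congr_deriv ?_).congr_of_mem (fun τ _ => fst_tr _ _) ht
    conv_rhs => rw [← red_aug (TrivSqZeroExt.fst _), ← redL_apply]
    congr 1
    simp only [TrivSqZeroExt.fst_sub, aug_sub, fst_dualCross, cr, IsUnitDual.aug_fst_tr, star_smul,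
      star_mul, star_aug, star_trivial]
    simp only [Pi.mul_apply, smul_sub, mul_smul_comm, smul_mul_assoc, mul_assoc, neg_mul, smul_neg,
      add_mul]
    abel
  · have key := redL.hasFDerivAt.comp_hasDerivWithinAt t
      (((hr.star.mul h1).mul hc).add (((hr.star.mul h2).add (hc.star.mul h1)).mul hr))
    refine (key.congr_deriv ?_).congr_of_mem (fun τ _ => snd_tr _ _) ht
    conv_rhs => rw [← red_aug (TrivSqZeroExt.snd _), ← redL_apply]
    congr 1
    simp only [TrivSqZeroExt.snd_sub, aug_sub, aug_add, snd_dualCross, cr, IsUnitDual.aug_fst_tr,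
      IsUnitDual.aug_snd_tr, star_smul, star_mul, star_add, star_aug, star_trivial]
    simp only [Pi.mul_apply, Pi.add_apply, smul_sub, smul_add, mul_smul_comm, smul_mul_assoc,
      mul_assoc, neg_mul, smul_neg, add_mul, mul_add]
    abel

theorem norm_sub_le_integral_of_hasDerivWithinAt {E : Type*} [NormedAddCommGroup E]
    [NormedSpace ℝ E] {f f' : ℝ → E} {B : ℝ → ℝ} (hf : ∀ t ∈ Icc 0 T,
      HasDerivWithinAt f (f' t) (Icc 0 T) t) (hB : ContinuousOn B (Icc 0 T))
    (hf' : ∀ t ∈ Icc 0 T, ‖f' t‖ ≤ B t) {t : ℝ} (ht : t ∈ Icc 0 T) :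
    ‖f t - f 0‖ ≤ ∫ τ in (0)..t, B τ := by
  have hsub : Icc 0 t ⊆ Icc 0 T := Icc_subset_Icc_right ht.2
  have hd : ∀ τ ∈ Ioo 0 t, HasDerivAt f (f' τ) τ := fun τ hτ =>
    (hf τ ⟨hτ.1.le, hτ.2.le.trans ht.2⟩).hasDerivAt
      (Icc_mem_nhds hτ.1 (hτ.2.trans_le ht.2))
  refine norm_sub_le_integral_of_norm_deriv_le_of_le ht.1
    (fun τ hτ => ((hf τ (hsub hτ)).continuousWithinAt).mono hsub)
    (fun τ hτ => (hd τ hτ).differentiableAt.differentiableWithinAt)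
    (Eventually.of_forall fun τ hτ => ?_) ?_
  · rw [(hd τ hτ).deriv]; exact hf' τ ⟨hτ.1.le, hτ.2.le.trans ht.2⟩
  · exact (hB.mono (by rw [uIcc_of_le ht.1]; exact hsub)).intervalIntegrable

/-- The size of a dual velocity. -/
noncomputable def speed (x : DualVec3) : ℝ := ‖x.fst‖ + ‖x.snd‖

theorem speed_nonneg (x : DualVec3) : 0 ≤ speed x := by unfold speed; positivity

theorem Kinematics.norm_fst_sub_le (h : Kinematics T D W) (hD : ∀ t ∈ Icc 0 T, IsUnitDual (D t))
    (hW : ContinuousOn (fun t => speed (W t)) (Icc 0 T)) {t : ℝ} (ht : t ∈ Icc 0 T) :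
    ‖(D t).fst - (D 0).fst‖ ≤ ∫ τ in (0)..t, speed (W τ) := by
  refine norm_sub_le_integral_of_hasDerivWithinAt (fun τ hτ => h.hasDerivWithinAt_fst hτ) hW
    (fun τ hτ => ?_) ht
  simp only [norm_smul, norm_mul, norm_aug, (hD τ hτ).norm_fst, speed]
  norm_num
  linarith [norm_nonneg (W τ).fst, norm_nonneg (W τ).snd]

theorem Kinematics.norm_snd_le (h : Kinematics T D W) (hD : ∀ t ∈ Icc 0 T, IsUnitDual (D t))
    (h0 : (D 0).snd = 0) (hW : ContinuousOn (fun t => speed (W t)) (Icc 0 T)) {t : ℝ}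
    (ht : t ∈ Icc 0 T) :
    ‖(D t).snd‖ ≤ ∫ τ in (0)..t, speed (W τ) := by
  have key := norm_sub_le_integral_of_hasDerivWithinAt
    (fun τ hτ => h.hasDerivWithinAt_snd_mul_star_fst hτ) hW (fun τ hτ => ?_) ht
  · simpa [h0, (hD t ht).norm_fst] using key
  simp only [norm_smul, norm_mul, norm_aug, (hD τ hτ).norm_fst, speed, Quaternion.norm_star]
  norm_num
  linarith [norm_nonneg (W τ).fst, norm_nonneg (W τ).snd]

end

end DualILC

/-! ### Absolutely continuous functions -/

namespace AbsolutelyContinuousOnInterval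

theorem clm_comp {E F : Type*} [NormedAddCommGroup E] [NormedSpace ℝ E]
    [NormedAddCommGroup F] [NormedSpace ℝ F] (L : E →L[ℝ] F) {f : ℝ → E} {a b : ℝ}
    (hf : AbsolutelyContinuousOnInterval f a b) :
    AbsolutelyContinuousOnInterval (fun t => L (f t)) a b := by
  unfold AbsolutelyContinuousOnInterval at hf ⊢
  refine squeeze_zero (fun _ => Finset.sum_nonneg fun _ _ => dist_nonneg) (fun E => ?_)
    (by simpa using hf.const_mul ‖L‖)
  rw [Finset.mul_sum]
  exact Finset.sum_le_sum fun i _ => L.dist_le_opNorm _ _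

theorem inner_euclidean {ι : Type*} [Fintype ι] {f g : ℝ → EuclideanSpace ℝ ι} {a b : ℝ}
    (hf : AbsolutelyContinuousOnInterval f a b) (hg : AbsolutelyContinuousOnInterval g a b) :
    AbsolutelyContinuousOnInterval (fun t => inner ℝ (f t) (g t)) a b := by
  classical
  have key : ∀ s : Finset ι,
      AbsolutelyContinuousOnInterval (fun t => ∑ i ∈ s, f t i * g t i) a b := by
    intro s
    induction s using Finset.induction_on with
    | empty =>
      simpa using (LipschitzWith.const (0 : ℝ)).lipschitzOnWith.absolutelyContinuousOnInterval
    | insert i s hi ih =>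
      simp only [Finset.sum_insert hi]
      exact ((hf.clm_comp (EuclideanSpace.proj i)).mul (hg.clm_comp (EuclideanSpace.proj i))).add ih
  simpa [PiLp.inner_apply, mul_comm] using key Finset.univ

theorem of_hasDerivWithinAt {E : Type*} [NormedAddCommGroup E] [NormedSpace ℝ E]
    {f f' : ℝ → E} {a b C : ℝ} (hab : a ≤ b)
    (hf : ∀ t ∈ Icc a b, HasDerivWithinAt f (f' t) (Icc a b) t)
    (hC : ∀ t ∈ Icc a b, ‖f' t‖ ≤ C) : AbsolutelyContinuousOnInterval f a b := by
  apply LipschitzOnWith.absolutelyContinuousOnInterval (K := C.toNNReal)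
  rw [uIcc_of_le hab]
  refine (convex_Icc a b).lipschitzOnWith_of_nnnorm_hasDerivWithin_le hf fun t ht => ?_
  rw [← NNReal.coe_le_coe, coe_nnnorm]
  exact (hC t ht).trans (Real.le_coe_toNNReal C)

/-- An absolutely continuous function does not increase if its derivative is nonpositive almost
everywhere. -/
theorem le_of_ae_hasDerivAt_nonpos {f : ℝ → ℝ} {a b : ℝ} (hab : a ≤ b)
    (hf : AbsolutelyContinuousOnInterval f a b)
    (hf' : ∀ᵐ t, t ∈ Ioo a b → ∃ f', HasDerivAt f f' t ∧ f' ≤ 0) : f b ≤ f a := by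
  have h := hf.integral_deriv_eq_sub
  have h2 : 0 ≤ ∫ t in a..b, -deriv f t := by
    rw [intervalIntegral.integral_of_le hab, integral_Ioc_eq_integral_Ioo]
    refine setIntegral_nonneg_of_ae_restrict ?_
    filter_upwards [(ae_restrict_iff' measurableSet_Ioo).2 hf'] with t ⟨f', ht, hle⟩
    simpa [ht.deriv] using hle
  rw [intervalIntegral.integral_neg, h] at h2
  linarith

end AbsolutelyContinuousOnInterval

namespace DualILC

/-! ### Sign values and the learning increment -/

theorem IsSgnValue.inner_eq {u x : Vec3} (h : IsSgnValue u x) :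
    inner ℝ x u = |x 0| + |x 1| + |x 2| := by
  have key : ∀ i, x i * u i = |x i| := by
    intro i
    rcases lt_trichotomy (x i) 0 with hx | hx | hx
    · rw [(h i).2.1 hx, abs_of_neg hx]; ring
    · simp [hx]
    · rw [(h i).1 hx, abs_of_pos hx]; ring
  rw [inner_vec3_eq, key, key, key]

theorem IsSgnValue.norm_le {u x : Vec3} (h : IsSgnValue u x) : ‖u‖ ≤ 3 := by
  have key : ∀ i, u i * u i ≤ 1 := fun i => by
    have := (h i).2.2
    rw [abs_le] at this
    nlinarith
  refine le_of_sq_le_sq ?_ (by norm_num)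
  rw [← real_inner_self_eq_norm_sq, inner_vec3_eq]
  linarith [key 0, key 1, key 2]

theorem IsSgnValue.norm_le_inner {u x : Vec3} (h : IsSgnValue u x) : ‖x‖ ≤ inner ℝ x u := by
  rw [h.inner_eq]
  refine le_of_sq_le_sq ?_ (by positivity)
  rw [← real_inner_self_eq_norm_sq, inner_vec3_eq]
  nlinarith [abs_mul_abs_self (x 0), abs_mul_abs_self (x 1), abs_mul_abs_self (x 2),
    mul_nonneg (abs_nonneg (x 0)) (abs_nonneg (x 1)),
    mul_nonneg (abs_nonneg (x 0)) (abs_nonneg (x 2)),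
    mul_nonneg (abs_nonneg (x 1)) (abs_nonneg (x 2))]

theorem IsSgnValue.inner_le {u x : Vec3} (h : IsSgnValue u x) : inner ℝ x u ≤ 3 * ‖x‖ := by
  have := real_inner_le_norm x u
  nlinarith [h.norm_le, norm_nonneg x]

theorem crs_funcOfSgn (x u y z : DualVec3) :
    crs x (funcOfSgn u y z) = (‖y.fst‖ ^ 2 + ‖z.fst‖ + 1) * inner ℝ x.fst u.fst +
      (‖cross y.fst y.snd + z.snd‖ + 1) * inner ℝ x.snd u.snd := by
  simp [crs, funcOfSgn, inner_smul_right]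

theorem speed_le_crs_funcOfSgn {x u : DualVec3} (hu : IsDualSgnValue u x) (y z : DualVec3) :
    speed x ≤ crs x (funcOfSgn u y z) := by
  rw [crs_funcOfSgn, speed]
  have h1 := hu.1.norm_le_inner
  have h2 := hu.2.norm_le_inner
  have h3 : 0 ≤ ‖y.fst‖ ^ 2 + ‖z.fst‖ := by positivity
  have h4 : 0 ≤ ‖cross y.fst y.snd + z.snd‖ := norm_nonneg _
  nlinarith [norm_nonneg x.fst, norm_nonneg x.snd]

/-! ### The energy of the tracking error -/

/-- The energy of the tracking error `(D, W)` relative to the reference attitude `σ`. -/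
noncomputable def energy (m : ℝ) (L : Vec3 →L[ℝ] Vec3) (kp σ : ℝ) (D : DualQuat) (W : DualVec3) :
    ℝ :=
  m / 2 * inner ℝ W.snd W.snd + 1 / 2 * inner ℝ W.fst (L W.fst)
    + kp * (‖D.snd‖ ^ 2 + ‖D.fst - σ • (1 : ℍ[ℝ])‖ ^ 2)

theorem inner_le_mul_norm {x y : Vec3} {c : ℝ} (h : ‖y‖ ≤ c) : inner ℝ x y ≤ c * ‖x‖ :=
  (real_inner_le_norm x y).trans (by rw [mul_comm]; gcongr)

theorem neg_inner_le_mul_norm {x y : Vec3} {c : ℝ} (h : ‖y‖ ≤ c) : -inner ℝ x y ≤ c * ‖x‖ := by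
  rw [← inner_neg_right]
  exact inner_le_mul_norm (by rwa [norm_neg])

/-- Along the closed loop the energy grows at most at the rate `(θ - θhat) crs (δω, func)`. -/
theorem energy_rate_le {m kp kd θ θhat σ : ℝ} {J : Matrix (Fin 3) (Fin 3) ℝ}
    {D : DualQuat} {W u ω w ωd ωd' d : DualVec3}
    (hm : 0 < m) (hkp : 0 < kp) (hkd : 0 < kd)
    (hJ : ∀ x y : Vec3, inner ℝ x (Matrix.toEuclideanCLM (𝕜 := ℝ) J y) =
      inner ℝ (Matrix.toEuclideanCLM (𝕜 := ℝ) J x) y)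
    (hmθ : m ≤ θ) (hJθ : ‖Matrix.toEuclideanCLM (𝕜 := ℝ) J‖ ≤ θ)
    (hd1 : ‖d.fst‖ ≤ θ) (hd2 : ‖d.snd‖ + 2 * kp ≤ θ)
    (hD : IsUnitDual D) (hσ : σ = 1 ∨ σ = -1)
    (hW : W = velocityError D ωd ω) (hu : IsDualSgnValue u W)
    (hdyn : inertia m J w =
      -dualCross ω (inertia m J ω) + control kp kd θhat D W u ωd ωd' + d) :
    m * inner ℝ W.snd (w - (tr D ωd' - dualCross W (tr D ωd))).snd +
      inner ℝ W.fst (Matrix.toEuclideanCLM (𝕜 := ℝ) J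
        (w - (tr D ωd' - dualCross W (tr D ωd))).fst) +
      kp * (inner ℝ (red (star D.fst * D.snd)) W.snd + σ * inner ℝ (red D.fst) W.fst) ≤
    (θ - θhat) * crs W (funcOfSgn u (tr D ωd) (tr D ωd')) := by
  set L := Matrix.toEuclideanCLM (𝕜 := ℝ) J with hL
  set y := tr D ωd with hy
  set z := tr D ωd' with hz
  have hω : ω = W + y := by rw [hW, velocityError, ← hy, sub_add_cancel]
  have e1 := congrArg TrivSqZeroExt.fst hdyn
  have e2 := congrArg TrivSqZeroExt.snd hdyn
  simp only [inertia, control, funcOfSgn, exch, dualConj, TrivSqZeroExt.fst_add,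
    TrivSqZeroExt.snd_add, TrivSqZeroExt.fst_sub, TrivSqZeroExt.snd_sub, TrivSqZeroExt.fst_neg,
    TrivSqZeroExt.snd_neg, TrivSqZeroExt.fst_smul, TrivSqZeroExt.snd_smul, fst_dual, snd_dual,
    fst_dualCross, snd_dualCross, cross_self_smul, cross_smul, add_zero, smul_zero, sub_zero,
    ← hL, ← hy, ← hz] at e1 e2
  have i1 := congrArg (fun v => inner ℝ W.snd v) e1
  have i2 := congrArg (fun v => inner ℝ W.fst v) e2
  have c1 := inner_cross_cancel_dual W.fst y.fst W.snd y.snd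
  have c2 := inner_cross_cancel W.fst y.fst (L W.fst) (L y.fst)
  rw [← map_add, ← TrivSqZeroExt.fst_add, ← hω] at c2
  rw [← TrivSqZeroExt.fst_add, ← TrivSqZeroExt.snd_add, ← hω] at c1
  simp only [inner_add_right, inner_sub_right, inner_neg_right, real_inner_smul_right] at i1 i2 c1 c2
  simp only [TrivSqZeroExt.fst_sub, TrivSqZeroExt.snd_sub, fst_dualCross, snd_dualCross, map_sub,
    inner_add_right, inner_sub_right]
  rw [hJ W.fst (cross W.fst y.fst), crs_funcOfSgn]
  have n1 := hu.1.norm_le_inner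
  have n2 := hu.2.norm_le_inner
  have hθ : 0 ≤ θ := hm.le.trans hmθ
  have b1 : m * -inner ℝ W.snd (cross y.fst y.snd + z.snd) ≤
      θ * (‖cross y.fst y.snd + z.snd‖ * ‖W.snd‖) :=
    (mul_le_mul_of_nonneg_left (neg_inner_le_mul_norm le_rfl) hm.le).trans (by gcongr)
  have b2 : inner ℝ W.snd d.fst ≤ θ * ‖W.snd‖ := inner_le_mul_norm hd1
  have b3 : -inner ℝ W.fst (cross y.fst (L y.fst)) ≤ θ * ‖y.fst‖ ^ 2 * ‖W.fst‖ := by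
    refine neg_inner_le_mul_norm ((norm_cross_le _ _).trans ?_)
    calc ‖y.fst‖ * ‖L y.fst‖ ≤ ‖y.fst‖ * (θ * ‖y.fst‖) := by gcongr; exact L.le_of_opNorm_le hJθ _
      _ = θ * ‖y.fst‖ ^ 2 := by ring
  have b4 : -inner ℝ W.fst (L z.fst) ≤ θ * ‖z.fst‖ * ‖W.fst‖ :=
    neg_inner_le_mul_norm (L.le_of_opNorm_le hJθ _)
  have b5 : inner ℝ W.fst (d.snd + ((σ - 1) * kp) • red D.fst) ≤ θ * ‖W.fst‖ := by
    refine inner_le_mul_norm ((norm_add_le _ _).trans (le_trans ?_ hd2))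
    have h3 := norm_red_le D.fst
    rw [hD.norm_fst] at h3
    rw [norm_smul, norm_mul, Real.norm_of_nonneg hkp.le]
    have h4 : ‖σ - 1‖ ≤ 2 := by rcases hσ with rfl | rfl <;> norm_num
    have : ‖σ - 1‖ * kp * ‖red D.fst‖ ≤ 2 * kp * 1 := by gcongr
    linarith
  have b6 : θ * ((‖cross y.fst y.snd + z.snd‖ + 1) * ‖W.snd‖) ≤
      θ * ((‖cross y.fst y.snd + z.snd‖ + 1) * inner ℝ W.snd u.snd) := by gcongr
  have b7 : θ * ((‖y.fst‖ ^ 2 + ‖z.fst‖ + 1) * ‖W.fst‖) ≤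
      θ * ((‖y.fst‖ ^ 2 + ‖z.fst‖ + 1) * inner ℝ W.fst u.fst) := by gcongr
  have k1 : 0 ≤ kd * inner ℝ W.fst W.fst := mul_nonneg hkd.le real_inner_self_nonneg
  have k2 : 0 ≤ kd * inner ℝ W.snd W.snd := mul_nonneg hkd.le real_inner_self_nonneg
  rw [inner_add_right] at b1
  rw [inner_add_right, real_inner_smul_right] at b5
  rw [real_inner_comm W.snd (red (star D.fst * D.snd)), real_inner_comm W.fst (red D.fst)]
  linear_combination b1 + b2 + b3 + b4 + b5 + b6 + b7 + k1 + k2 + i1 + i2 + m * c1 + c2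

end DualILC

namespace DualILC

theorem toEuclideanCLM_inner_comm {J : Matrix (Fin 3) (Fin 3) ℝ} (hJ : J.PosDef) (x y : Vec3) :
    inner ℝ x (Matrix.toEuclideanCLM (𝕜 := ℝ) J y) =
      inner ℝ (Matrix.toEuclideanCLM (𝕜 := ℝ) J x) y := by
  rw [← ContinuousLinearMap.adjoint_inner_left, ← ContinuousLinearMap.star_eq_adjoint, ← map_star,
    Matrix.star_eq_conjTranspose, hJ.isHermitian.eq]

theorem exists_norm_sq_le_inner_toEuclideanCLM {J : Matrix (Fin 3) (Fin 3) ℝ} (hJ : J.PosDef) :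
    ∃ c > 0, ∀ x : Vec3, c * ‖x‖ ^ 2 ≤ inner ℝ x (Matrix.toEuclideanCLM (𝕜 := ℝ) J x) := by
  set L := Matrix.toEuclideanCLM (𝕜 := ℝ) J with hL
  have hpos : ∀ x : Vec3, x ≠ 0 → 0 < inner ℝ x (L x) := by
    intro x hx
    have h := hJ.dotProduct_mulVec_pos (x := x.ofLp) (by simpa using hx)
    simpa [PiLp.inner_apply, hL, dotProduct, Matrix.toEuclideanCLM_toLp, mul_comm] using h
  have hcont : Continuous fun x : Vec3 => inner ℝ x (L x) :=
    continuous_id.inner L.continuous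
  obtain ⟨x₀, hx₀, hmin⟩ := (isCompact_sphere (0 : Vec3) 1).exists_isMinOn
    (NormedSpace.sphere_nonempty.2 zero_le_one) hcont.continuousOn
  have hx₀' : ‖x₀‖ = 1 := by simpa using hx₀
  refine ⟨inner ℝ x₀ (L x₀), hpos x₀ (by rintro rfl; simp at hx₀'), fun x => ?_⟩
  rcases eq_or_ne x 0 with rfl | hx
  · simp
  have hn : ‖x‖ ≠ 0 := norm_ne_zero_iff.2 hx
  have h := hmin (show ‖x‖⁻¹ • x ∈ Metric.sphere (0 : Vec3) 1 by simp [norm_smul, hn])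
  simp only [mem_ofPred_eq, map_smul, real_inner_smul_left, real_inner_smul_right] at h
  calc inner ℝ x₀ (L x₀) * ‖x‖ ^ 2 ≤ ‖x‖⁻¹ * (‖x‖⁻¹ * inner ℝ x (L x)) * ‖x‖ ^ 2 := by gcongr
    _ = inner ℝ x (L x) := by field_simp

theorem exists_speed_le_of_energy_le {m kp : ℝ} (hm : 0 < m) (hkp : 0 < kp)
    {J : Matrix (Fin 3) (Fin 3) ℝ} (hJ : J.PosDef) :
    ∃ C, 0 ≤ C ∧ ∀ (σ R : ℝ) (D D₀ : DualQuat) (W W₀ : DualVec3),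
      energy m (Matrix.toEuclideanCLM (𝕜 := ℝ) J) kp σ D W ≤
        energy m (Matrix.toEuclideanCLM (𝕜 := ℝ) J) kp σ D₀ W₀ →
      ‖D₀.snd‖ ≤ R → ‖D₀.fst - σ • (1 : ℍ[ℝ])‖ ≤ R → speed W ≤ C * (speed W₀ + R) := by
  obtain ⟨c, hc, hJc⟩ := exists_norm_sq_le_inner_toEuclideanCLM hJ
  set L := Matrix.toEuclideanCLM (𝕜 := ℝ) J with hL
  set c' := min m c with hc'
  have hc'0 : 0 < c' := lt_min hm hc
  set K := m + ‖L‖ + 4 * kp with hK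
  have hK0 : 0 ≤ K := by positivity
  refine ⟨√(2 * K / c'), Real.sqrt_nonneg _, fun σ R D D₀ W W₀ hE h1 h2 => ?_⟩
  have hR : 0 ≤ R := (norm_nonneg _).trans h1
  have hlow : c' / 4 * speed W ^ 2 ≤ energy m L kp σ D W := by
    have h3 := hJc W.fst
    have h4 : c' * ‖W.fst‖ ^ 2 ≤ c * ‖W.fst‖ ^ 2 := by gcongr; exact min_le_right _ _
    have h5 : c' * ‖W.snd‖ ^ 2 ≤ m * ‖W.snd‖ ^ 2 := by gcongr; exact min_le_left _ _
    have h6 : 0 ≤ kp * (‖D.snd‖ ^ 2 + ‖D.fst - σ • (1 : ℍ[ℝ])‖ ^ 2) := by positivity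
    have h7 : speed W ^ 2 ≤ 2 * (‖W.fst‖ ^ 2 + ‖W.snd‖ ^ 2) := by
      unfold speed; nlinarith [sq_nonneg (‖W.fst‖ - ‖W.snd‖)]
    unfold energy
    rw [real_inner_self_eq_norm_sq]
    nlinarith [mul_le_mul_of_nonneg_left h7 hc'0.le]
  have hup : energy m L kp σ D₀ W₀ ≤ K / 2 * (speed W₀ + R) ^ 2 := by
    have hs := speed_nonneg W₀
    have g1 : ‖W₀.fst‖ ≤ speed W₀ + R := by
      unfold speed; linarith [norm_nonneg W₀.snd]
    have g2 : ‖W₀.snd‖ ≤ speed W₀ + R := by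
      unfold speed; linarith [norm_nonneg W₀.fst]
    have g3 : inner ℝ W₀.fst (L W₀.fst) ≤ ‖L‖ * (speed W₀ + R) ^ 2 := by
      calc inner ℝ W₀.fst (L W₀.fst) ≤ ‖W₀.fst‖ * ‖L W₀.fst‖ := real_inner_le_norm _ _
        _ ≤ ‖W₀.fst‖ * (‖L‖ * ‖W₀.fst‖) := by gcongr; exact L.le_opNorm _
        _ = ‖L‖ * ‖W₀.fst‖ ^ 2 := by ring
        _ ≤ ‖L‖ * (speed W₀ + R) ^ 2 := by gcongr
    have g4 : m * ‖W₀.snd‖ ^ 2 ≤ m * (speed W₀ + R) ^ 2 := by gcongr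
    have g5 : kp * (‖D₀.snd‖ ^ 2 + ‖D₀.fst - σ • (1 : ℍ[ℝ])‖ ^ 2) ≤
        kp * ((speed W₀ + R) ^ 2 + (speed W₀ + R) ^ 2) := by
      gcongr <;> linarith
    unfold energy
    rw [real_inner_self_eq_norm_sq, hK]
    linarith
  have hsq : speed W ^ 2 ≤ (2 * K / c') * (speed W₀ + R) ^ 2 := by
    rw [div_mul_eq_mul_div, le_div_iff₀ hc'0]
    linarith
  refine le_of_sq_le_sq ?_ (by have := speed_nonneg W₀; positivity)
  rw [mul_pow, Real.sq_sqrt (by positivity)]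
  exact hsq

theorem Kinematics.hasDerivWithinAt_poseEnergy {T σ : ℝ} {D : ℝ → DualQuat} {W : ℝ → DualVec3}
    {t : ℝ} (h : Kinematics T D W) (ht : t ∈ Icc 0 T) :
    HasDerivWithinAt (fun τ => ‖(D τ).snd‖ ^ 2 + ‖(D τ).fst - σ • (1 : ℍ[ℝ])‖ ^ 2)
      (inner ℝ (red (star (D t).fst * (D t).snd)) (W t).snd
        + σ * inner ℝ (red (D t).fst) (W t).fst) (Icc 0 T) t := by
  have k3 := (h.hasDerivWithinAt_snd ht).norm_sq
  have k4 := ((h.hasDerivWithinAt_fst ht).sub_const (σ • (1 : ℍ[ℝ]))).norm_sq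
  refine (k3.add k4).congr_deriv (congrArg₂ (· + ·) ?_ ?_)
  · simp [inner_quaternion_eq, inner_vec3_eq]; ring
  · simp [inner_quaternion_eq, inner_vec3_eq]; ring

theorem Kinematics.hasDerivWithinAt_energy {T m kp σ : ℝ} {J : Matrix (Fin 3) (Fin 3) ℝ}
    (hJ : J.PosDef) {D : ℝ → DualQuat} {W : ℝ → DualVec3} {W' : DualVec3} {t : ℝ}
    (h : Kinematics T D W) (ht : t ∈ Icc 0 T)
    (hW : HasDualDerivWithinAt W W' (Icc 0 T) t) :
    HasDerivWithinAt (fun τ => energy m (Matrix.toEuclideanCLM (𝕜 := ℝ) J) kp σ (D τ) (W τ))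
      (m * inner ℝ (W t).snd W'.snd + inner ℝ (W t).fst (Matrix.toEuclideanCLM (𝕜 := ℝ) J W'.fst) +
        kp * (inner ℝ (red (star (D t).fst * (D t).snd)) (W t).snd
          + σ * inner ℝ (red (D t).fst) (W t).fst)) (Icc 0 T) t := by
  set L := Matrix.toEuclideanCLM (𝕜 := ℝ) J with hL
  have k1 := (hW.2.inner ℝ hW.2).const_mul (m / 2)
  have k2 := (hW.1.inner ℝ (L.hasFDerivAt.comp_hasDerivWithinAt t hW.1)).const_mul (1 / 2)
  refine ((k1.add k2).add ((h.hasDerivWithinAt_poseEnergy ht).const_mul kp)).congr_deriv ?_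
  have e2 : inner ℝ W'.fst (L (W t).fst) = inner ℝ (W t).fst (L W'.fst) := by
    rw [toEuclideanCLM_inner_comm hJ, real_inner_comm]
  simp only [Function.comp_apply]
  rw [e2, real_inner_comm W'.snd (W t).snd]
  ring

section Monotone

variable {T m : ℝ} {J : Matrix (Fin 3) (Fin 3) ℝ} {D : ℝ → DualQuat} {ω ωd ωd' : ℝ → DualVec3}

theorem HasDualDerivWithinAt.sub {V : Type*} [NormedAddCommGroup V] [NormedSpace ℝ V]
    {f g : ℝ → DualNumber V} {f' g' : DualNumber V} {s : Set ℝ} {t : ℝ}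
    (hf : HasDualDerivWithinAt f f' s t) (hg : HasDualDerivWithinAt g g' s t) :
    HasDualDerivWithinAt (fun τ => f τ - g τ) (f' - g') s t :=
  ⟨hf.1.sub hg.1, hf.2.sub hg.2⟩

/-- The velocity error of a Carathéodory solution is absolutely continuous. -/
theorem dualAbsolutelyContinuous_velocityError (hT : 0 ≤ T)
    (hD : ∀ t ∈ Icc 0 T, IsUnitDual (D t))
    (hkin : Kinematics T D (fun t => velocityError (D t) (ωd t) (ω t)))
    (hωd : ∀ t ∈ Icc 0 T, HasDualDerivWithinAt ωd (ωd' t) (Icc 0 T) t)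
    (hωd' : ∃ C : ℝ, ∀ t ∈ Icc 0 T, ‖(ωd' t).fst‖ ≤ C ∧ ‖(ωd' t).snd‖ ≤ C)
    (hω : DualAbsolutelyContinuous ω T) :
    DualAbsolutelyContinuous (fun t => velocityError (D t) (ωd t) (ω t)) T := by
  set W := fun t => velocityError (D t) (ωd t) (ω t) with hW
  obtain ⟨C, hC⟩ := hωd'
  have hy := fun t (ht : t ∈ Icc 0 T) => hkin.hasDualDerivWithinAt_tr ht (hωd t ht)
  have hyc1 : ContinuousOn (fun t => (tr (D t) (ωd t)).fst) (Icc 0 T) := fun t ht =>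
    (hy t ht).1.continuousWithinAt
  have hyc2 : ContinuousOn (fun t => (tr (D t) (ωd t)).snd) (Icc 0 T) := fun t ht =>
    (hy t ht).2.continuousWithinAt
  have hDc : ContinuousOn (fun t => (D t).snd) (Icc 0 T) := fun t ht =>
    (hkin.hasDerivWithinAt_snd ht).continuousWithinAt
  have hωc1 := hω.1.continuousOn
  have hωc2 := hω.2.continuousOn
  rw [uIcc_of_le hT] at hωc1 hωc2
  have hWc1 : ContinuousOn (fun t => (W t).fst) (Icc 0 T) :=
    hωc1.sub hyc1
  have hWc2 : ContinuousOn (fun t => (W t).snd) (Icc 0 T) :=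
    hωc2.sub hyc2
  obtain ⟨Y1, hY1⟩ := isCompact_Icc.exists_bound_of_continuousOn hyc1
  obtain ⟨Y2, hY2⟩ := isCompact_Icc.exists_bound_of_continuousOn hyc2
  obtain ⟨W1, hW1⟩ := isCompact_Icc.exists_bound_of_continuousOn hWc1
  obtain ⟨W2, hW2⟩ := isCompact_Icc.exists_bound_of_continuousOn hWc2
  obtain ⟨E, hE⟩ := isCompact_Icc.exists_bound_of_continuousOn hDc
  have hcr : ∀ {x y : Vec3} {a b : ℝ}, ‖x‖ ≤ a → ‖y‖ ≤ b → ‖cross x y‖ ≤ a * b :=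
    fun {x y a b} hx hy => (norm_cross_le x y).trans
      (mul_le_mul hx hy (norm_nonneg _) ((norm_nonneg _).trans hx))
  have hAC1 : AbsolutelyContinuousOnInterval (fun t => (tr (D t) (ωd t)).fst) 0 T := by
    refine .of_hasDerivWithinAt (C := C + W1 * Y1) hT (fun t ht => (hy t ht).1) fun t ht => ?_
    rw [TrivSqZeroExt.fst_sub, fst_dualCross]
    refine (norm_sub_le _ _).trans (add_le_add ?_ (hcr (hW1 t ht) (hY1 t ht)))
    rw [(hD t ht).norm_fst_tr]; exact (hC t ht).1
  have hAC2 : AbsolutelyContinuousOnInterval (fun t => (tr (D t) (ωd t)).snd) 0 T := by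
    refine .of_hasDerivWithinAt (C := (C + 2 * E * C) + (W1 * Y2 + W2 * Y1)) hT
      (fun t ht => (hy t ht).2) fun t ht => ?_
    rw [TrivSqZeroExt.snd_sub, snd_dualCross]
    refine (norm_sub_le _ _).trans (add_le_add ?_ ((norm_add_le _ _).trans
      (add_le_add (hcr (hW1 t ht) (hY2 t ht)) (hcr (hW2 t ht) (hY1 t ht)))))
    have hE0 : 0 ≤ E := (norm_nonneg _).trans (hE t ht)
    refine ((hD t ht).norm_snd_tr_le _).trans ?_
    gcongr
    exacts [(hC t ht).2, hE t ht, (hC t ht).1]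
  exact ⟨hω.1.sub hAC1, hω.2.sub hAC2⟩

/-- While the estimate dominates the uncertainty, the energy does not increase. -/
theorem energy_le_energy_of_le_estimate {kp kd θ σ : ℝ} {f d u : ℝ → DualVec3} {θhat : ℝ → ℝ}
    {α β : ℝ} (hα : 0 ≤ α) (hαβ : α ≤ β) (hβ : β ≤ T)
    (hm : 0 < m) (hkp : 0 < kp) (hkd : 0 < kd) (hJ : J.PosDef)
    (hmθ : m ≤ θ) (hJθ : ‖Matrix.toEuclideanCLM (𝕜 := ℝ) J‖ ≤ θ)
    (hd1 : ∀ t ∈ Icc 0 T, ‖(d t).fst‖ ≤ θ) (hd2 : ∀ t ∈ Icc 0 T, ‖(d t).snd‖ + 2 * kp ≤ θ)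
    (hD : ∀ t ∈ Icc 0 T, IsUnitDual (D t)) (hσ : σ = 1 ∨ σ = -1)
    (hkin : Kinematics T D (fun t => velocityError (D t) (ωd t) (ω t)))
    (hωd : ∀ t ∈ Icc 0 T, HasDualDerivWithinAt ωd (ωd' t) (Icc 0 T) t)
    (hωd' : ∃ C : ℝ, ∀ t ∈ Icc 0 T, ‖(ωd' t).fst‖ ≤ C ∧ ‖(ωd' t).snd‖ ≤ C)
    (hdyn : Dynamics T m J ω f d)
    (hu : ∀ t ∈ Icc 0 T, IsDualSgnValue (u t) (velocityError (D t) (ωd t) (ω t)))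
    (hf : ∀ t ∈ Icc 0 T, f t = control kp kd (θhat t) (D t)
      (velocityError (D t) (ωd t) (ω t)) (u t) (ωd t) (ωd' t))
    (hθ : ∀ t ∈ Ioc α β, θ ≤ θhat t) :
    energy m (Matrix.toEuclideanCLM (𝕜 := ℝ) J) kp σ (D β) (velocityError (D β) (ωd β) (ω β)) ≤
      energy m (Matrix.toEuclideanCLM (𝕜 := ℝ) J) kp σ (D α)
        (velocityError (D α) (ωd α) (ω α)) := by
  have hT : 0 ≤ T := hα.trans (hαβ.trans hβ)
  have hAC := dualAbsolutelyContinuous_velocityError hT hD hkin hωd hωd' hdyn.1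
  set W := fun t => velocityError (D t) (ωd t) (ω t) with hW
  set L := Matrix.toEuclideanCLM (𝕜 := ℝ) J with hL
  have hE : AbsolutelyContinuousOnInterval (fun t => energy m L kp σ (D t) (W t)) 0 T := by
    have a1 := (hAC.2.inner_euclidean hAC.2).const_mul (m / 2)
    have a2 := (hAC.1.inner_euclidean (hAC.1.clm_comp L)).const_mul (1 / 2)
    have hWc1 := hAC.1.continuousOn
    have hWc2 := hAC.2.continuousOn
    rw [uIcc_of_le hT] at hWc1 hWc2
    have hc : ContinuousOn (fun t => inner ℝ (red (star (D t).fst * (D t).snd)) (W t).snd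
          + σ * inner ℝ (red (D t).fst) (W t).fst) (Icc 0 T) := by
      have hr : ContinuousOn (fun t => (D t).fst) (Icc 0 T) := fun t ht =>
        (hkin.hasDerivWithinAt_fst ht).continuousWithinAt
      have hc : ContinuousOn (fun t => (D t).snd) (Icc 0 T) := fun t ht =>
        (hkin.hasDerivWithinAt_snd ht).continuousWithinAt
      exact ((redL.continuous.comp_continuousOn (hr.star.mul hc)).inner hWc2).add
        (((redL.continuous.comp_continuousOn hr).inner hWc1).const_mul σ)
    obtain ⟨C, hC⟩ := isCompact_Icc.exists_bound_of_continuousOn hc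
    exact (a1.add a2).add
      ((AbsolutelyContinuousOnInterval.of_hasDerivWithinAt hT
        (fun t ht => hkin.hasDerivWithinAt_poseEnergy ht) hC).const_mul kp)
  refine (hE.mono ?_).le_of_ae_hasDerivAt_nonpos hαβ ?_
  · rw [uIcc_of_le hαβ, uIcc_of_le hT]; exact Icc_subset_Icc hα hβ
  have hae := (ae_restrict_iff' measurableSet_Icc).1 hdyn.2
  filter_upwards [hae] with t h ht
  have htT : t ∈ Icc 0 T := ⟨hα.trans ht.1.le, ht.2.le.trans hβ⟩
  obtain ⟨w, hw, heq⟩ := h htT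
  have hW' : HasDualDerivWithinAt W _ (Icc 0 T) t :=
    hw.sub (hkin.hasDualDerivWithinAt_tr htT (hωd t htT))
  refine ⟨_, (hkin.hasDerivWithinAt_energy hJ htT hW').hasDerivAt
    (Icc_mem_nhds (hα.trans_lt ht.1) (ht.2.trans_le hβ)), ?_⟩
  rw [hf t htT] at heq
  refine (energy_rate_le hm hkp hkd (toEuclideanCLM_inner_comm hJ) hmθ hJθ (hd1 t htT)
    (hd2 t htT) (hD t htT) hσ rfl (hu t htT) heq).trans ?_
  exact mul_nonpos_of_nonpos_of_nonneg (sub_nonpos.2 (hθ t ⟨ht.1, ht.2.le⟩))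
    ((speed_nonneg _).trans (speed_le_crs_funcOfSgn (hu t htT) _ _))

end Monotone

end DualILC

namespace DualILC

/-! ### The segment-based projection -/

section Projection

variable {s : ℕ} {h : ℕ → ℝ} {kc : ℝ} {x : ℝ → ℝ}

theorem segment_le (h_lt : ∀ j < s, h j < h (j + 1)) {i j : ℕ} (hij : i ≤ j) (hj : j ≤ s) :
    h i ≤ h j := by
  induction j, hij using Nat.le_induction with
  | base => exact le_rfl
  | succ j _ ih => exact (ih (by omega)).trans (h_lt j (by omega)).le

theorem segIndex_eq (h_lt : ∀ j < s, h j < h (j + 1)) {j : ℕ} (hj : j < s) {t : ℝ}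
    (ht : t ∈ Ioc (h j) (h (j + 1))) : segIndex s h t = j + 1 := by
  refine le_antisymm (Nat.sInf_le ⟨by omega, by omega, ht.2⟩)
    (le_csInf ⟨j + 1, by omega, by omega, ht.2⟩ ?_)
  rintro i ⟨_, _, hi⟩
  by_contra hlt
  exact absurd (hi.trans (segment_le h_lt (by omega : i ≤ j) hj.le)) (not_le.2 ht.1)

theorem segIndex_initial (h_lt : ∀ j < s, h j < h (j + 1)) (hs : 1 ≤ s) :
    segIndex s h (h 0) = 1 := by
  have hmem : 1 ∈ {j : ℕ | 1 ≤ j ∧ j ≤ s ∧ h 0 ≤ h j} := ⟨le_rfl, hs, (h_lt 0 hs).le⟩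
  exact le_antisymm (Nat.sInf_le hmem) (le_csInf ⟨1, hmem⟩ fun i hi => hi.1)

theorem le_proj (t : ℝ) : x t ≤ proj s h kc x t := by
  unfold proj; split_ifs with hlt
  · exact le_rfl
  · exact not_lt.1 hlt

theorem proj_le_of_index (h_lt : ∀ j < s, h j < h (j + 1)) (hkc : 0 < kc) {j : ℕ} (hj : j < s)
    {t B : ℝ} (hi : segIndex s h t = j + 1) (ht : x t ≤ B)
    (hB : ∀ τ ∈ Ioc (h j) (h (j + 1)), x τ ≤ B) : proj s h kc x t ≤ B := by
  unfold proj; split_ifs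
  · exact ht
  rw [hi, Nat.add_sub_cancel]
  have := csSup_le ((nonempty_Ioc.2 (h_lt j hj)).image x) (forall_mem_image.2 hB)
  linarith

theorem proj_le (h_lt : ∀ j < s, h j < h (j + 1)) (hkc : 0 < kc) {j : ℕ} (hj : j < s)
    {t B : ℝ} (ht : t ∈ Ioc (h j) (h (j + 1)))
    (hB : ∀ τ ∈ Ioc (h j) (h (j + 1)), x τ ≤ B) : proj s h kc x t ≤ B :=
  proj_le_of_index h_lt hkc hj (segIndex_eq h_lt hj ht) (hB t ht) hB

theorem le_proj_of_mem (h_lt : ∀ j < s, h j < h (j + 1)) {j : ℕ} (hj : j < s) {t τ B : ℝ}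
    (ht : t ∈ Ioc (h j) (h (j + 1))) (hτ : τ ∈ Ioc (h j) (h (j + 1)))
    (hB : ∀ τ ∈ Ioc (h j) (h (j + 1)), x τ ≤ B) : x τ - kc ≤ proj s h kc x t := by
  have h1 : x τ ≤ sSup (x '' Ioc (h j) (h (j + 1))) :=
    le_csSup ⟨B, forall_mem_image.2 hB⟩ (mem_image_of_mem x hτ)
  unfold proj
  rw [segIndex_eq h_lt hj ht, Nat.add_sub_cancel]
  split_ifs <;> linarith

end Projection

/-! ### Convergence of the learning process -/

section Learning

/-- The data of a learning process: `a k` is the size of the error of iteration `k`, `g k` the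
increment of the estimate, `e k` a quantity that is controlled by the accumulated error. -/
structure LearningProcess (T : ℝ) (s : ℕ) (h : ℕ → ℝ) (kc kθ θ C : ℝ)
    (a g e θhat : ℕ → ℝ → ℝ) : Prop where
  one_le : 1 ≤ s
  start : h 0 = 0
  last : h s = T
  lt : ∀ j < s, h j < h (j + 1)
  kc_pos : 0 < kc
  kθ_pos : 0 < kθ
  θ_nonneg : 0 ≤ θ
  C_nonneg : 0 ≤ C
  continuousOn : ∀ k, ContinuousOn (a k) (Icc 0 T)
  nonneg : ∀ k, ∀ t ∈ Icc 0 T, 0 ≤ a k t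
  initial : ∀ k, a k 0 = 0
  error_le : ∀ k, ∀ t ∈ Icc 0 T, a k t ≤ g k t
  increment_le : ∀ k, ∀ t ∈ Icc 0 T, g k t ≤ C * (1 + e k t) * a k t
  accumulated_le : ∀ k, ∀ t ∈ Icc 0 T, e k t ≤ ∫ τ in (0)..t, a k τ
  saturated : ∀ k, ∀ j < s, (∀ t ∈ Ioc (h j) (h (j + 1)), θ ≤ θhat k t) →
    ∀ t ∈ Ioc (h j) (h (j + 1)), a k t ≤ C * (a k (h j) + ∫ τ in (0)..(h j), a k τ)
  zero : ∀ t ∈ Icc 0 T, θhat 0 t = 0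
  succ : ∀ k, ∀ t ∈ Icc 0 T, θhat (k + 1) t = proj s h kc (θhat k) t + kθ * g (k + 1) t

namespace LearningProcess

variable {T : ℝ} {s : ℕ} {h : ℕ → ℝ} {kc kθ θ C : ℝ} {a g e θhat : ℕ → ℝ → ℝ}

theorem node_mem (P : LearningProcess T s h kc kθ θ C a g e θhat)
    {j : ℕ} (hj : j ≤ s) : h j ∈ Icc 0 T := by
  refine ⟨?_, ?_⟩
  · rw [← P.start]; exact segment_le P.lt (Nat.zero_le _) hj
  · rw [← P.last]; exact segment_le P.lt hj le_rfl

theorem segment_subset (P : LearningProcess T s h kc kθ θ C a g e θhat)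
    {j : ℕ} (hj : j < s) : Ioc (h j) (h (j + 1)) ⊆ Icc 0 T := fun _ ht =>
  ⟨(P.node_mem hj.le).1.trans ht.1.le, ht.2.trans (P.node_mem (Nat.succ_le_of_lt hj)).2⟩

theorem T_nonneg (P : LearningProcess T s h kc kθ θ C a g e θhat) : 0 ≤ T :=
  (P.node_mem (Nat.zero_le _)).1.trans (P.node_mem (Nat.zero_le _)).2

theorem increment_nonneg (P : LearningProcess T s h kc kθ θ C a g e θhat)
    (k : ℕ) {t : ℝ} (ht : t ∈ Icc 0 T) : 0 ≤ g k t :=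
  (P.nonneg k t ht).trans (P.error_le k t ht)

theorem intervalIntegrable (P : LearningProcess T s h kc kθ θ C a g e θhat)
    (k : ℕ) {t : ℝ} (ht : t ∈ Icc 0 T) :
    IntervalIntegrable (a k) volume 0 t := by
  refine ((P.continuousOn k).mono ?_).intervalIntegrable
  rw [uIcc_of_le ht.1]; exact Icc_subset_Icc_right ht.2

theorem integral_nonneg (P : LearningProcess T s h kc kθ θ C a g e θhat)
    (k : ℕ) {t : ℝ} (ht : t ∈ Icc 0 T) : 0 ≤ ∫ τ in (0)..t, a k τ :=
  intervalIntegral.integral_nonneg ht.1 fun τ hτ => P.nonneg k τ ⟨hτ.1, hτ.2.trans ht.2⟩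

theorem sum_integral_le (P : LearningProcess T s h kc kθ θ C a g e θhat)
    {t B : ℝ} (ht : t ∈ Icc 0 T) (K : ℕ) (hB0 : 0 ≤ B)
    (hB : ∀ τ ∈ Icc 0 t, ∑ k ∈ Finset.range K, a k τ ≤ B) :
    ∑ k ∈ Finset.range K, ∫ τ in (0)..t, a k τ ≤ T * B := by
  have hint : IntervalIntegrable (fun τ => ∑ k ∈ Finset.range K, a k τ) volume 0 t := by
    simpa only [Finset.sum_fn] using
      IntervalIntegrable.sum (Finset.range K) (f := a) fun k _ => P.intervalIntegrable k ht
  rw [← intervalIntegral.integral_finsetSum fun k _ => P.intervalIntegrable k ht]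
  calc ∫ τ in (0)..t, ∑ k ∈ Finset.range K, a k τ ≤ ∫ _ in (0)..t, B :=
        intervalIntegral.integral_mono_on ht.1
          hint intervalIntegrable_const hB
    _ = t * B := by simp
    _ ≤ T * B := by gcongr; exact ht.2

theorem integral_le (P : LearningProcess T s h kc kθ θ C a g e θhat)
    {t B : ℝ} (ht : t ∈ Icc 0 T) (k : ℕ) (hB0 : 0 ≤ B)
    (hB : ∀ τ ∈ Icc 0 t, a k τ ≤ B) : ∫ τ in (0)..t, a k τ ≤ T * B := by
  calc ∫ τ in (0)..t, a k τ ≤ ∫ _ in (0)..t, B :=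
        intervalIntegral.integral_mono_on ht.1 (P.intervalIntegrable k ht)
          intervalIntegrable_const hB
    _ = t * B := by simp
    _ ≤ T * B := by gcongr; exact ht.2

theorem increment_le_of_bound (P : LearningProcess T s h kc kθ θ C a g e θhat)
    {t B : ℝ} (ht : t ∈ Icc 0 T) (k : ℕ) (hB0 : 0 ≤ B)
    (hB : ∀ τ ∈ Icc 0 t, a k τ ≤ B) : g k t ≤ C * (1 + T * B) * a k t := by
  have h1 := P.C_nonneg
  have h2 := P.nonneg k t ht
  refine (P.increment_le k t ht).trans ?_
  gcongr
  exact (P.accumulated_le k t ht).trans (P.integral_le ht k hB0 hB)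

theorem exists_error_bound (P : LearningProcess T s h kc kθ θ C a g e θhat)
    (k : ℕ) : ∃ A, 0 ≤ A ∧ ∀ t ∈ Icc 0 T, a k t ≤ A := by
  obtain ⟨A, hA⟩ := isCompact_Icc.exists_bound_of_continuousOn (P.continuousOn k)
  exact ⟨A, (norm_nonneg _).trans (hA 0 ⟨le_rfl, P.T_nonneg⟩), fun t ht =>
    (Real.le_norm_self _).trans (hA t ht)⟩

theorem estimate_succ_ge (P : LearningProcess T s h kc kθ θ C a g e θhat)
    (k : ℕ) {t : ℝ} (ht : t ∈ Icc 0 T) :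
    θhat k t + kθ * g (k + 1) t ≤ θhat (k + 1) t := by
  rw [P.succ k t ht]; gcongr; exact le_proj t

theorem estimate_mono (P : LearningProcess T s h kc kθ θ C a g e θhat)
    {k l : ℕ} (hkl : k ≤ l) {t : ℝ} (ht : t ∈ Icc 0 T) :
    θhat k t ≤ θhat l t := by
  induction l, hkl using Nat.le_induction with
  | base => exact le_rfl
  | succ l _ ih =>
    have h1 := P.estimate_succ_ge l ht
    have h2 := mul_nonneg P.kθ_pos.le (P.increment_nonneg (l + 1) ht)
    linarith

theorem estimate_nonneg (P : LearningProcess T s h kc kθ θ C a g e θhat)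
    (k : ℕ) {t : ℝ} (ht : t ∈ Icc 0 T) : 0 ≤ θhat k t := by
  rw [← P.zero t ht]; exact P.estimate_mono (Nat.zero_le k) ht

theorem sum_error_le_estimate (P : LearningProcess T s h kc kθ θ C a g e θhat)
    (K : ℕ) {t : ℝ} (ht : t ∈ Icc 0 T) :
    kθ * ∑ k ∈ Finset.range K, a (k + 1) t ≤ θhat K t := by
  induction K with
  | zero => simp [P.zero t ht]
  | succ K ih =>
    rw [Finset.sum_range_succ, mul_add]
    have h1 := P.estimate_succ_ge K ht
    have h2 := mul_le_mul_of_nonneg_left (P.error_le (K + 1) t ht) P.kθ_pos.le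
    linarith

theorem exists_estimate_bound (P : LearningProcess T s h kc kθ θ C a g e θhat)
    (k : ℕ) {j : ℕ} (hj : j < s) :
    ∃ M, 0 ≤ M ∧ ∀ t ∈ Ioc (h j) (h (j + 1)), θhat k t ≤ M := by
  induction k with
  | zero => exact ⟨0, le_rfl, fun t ht => (P.zero t (P.segment_subset hj ht)).le⟩
  | succ k ih =>
    obtain ⟨M, hM0, hM⟩ := ih
    obtain ⟨A, hA0, hA⟩ := P.exists_error_bound (k + 1)
    have hC := P.C_nonneg
    have hT := P.T_nonneg
    have hk := P.kθ_pos
    refine ⟨M + kθ * (C * (1 + T * A) * A), by positivity, fun t ht => ?_⟩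
    have htT := P.segment_subset hj ht
    rw [P.succ k t htT]
    gcongr
    · exact proj_le P.lt P.kc_pos hj ht hM
    · refine (P.increment_le_of_bound htT (k + 1) hA0 fun τ hτ =>
        hA τ ⟨hτ.1, hτ.2.trans htT.2⟩).trans ?_
      gcongr
      exact hA t htT

theorem error_le_of_sum_le (P : LearningProcess T s h kc kθ θ C a g e θhat)
    {t B : ℝ} (ht : t ∈ Icc 0 T)
    (hB : ∀ K, ∑ k ∈ Finset.range K, a k t ≤ B) (k : ℕ) : a k t ≤ B :=
  (Finset.single_le_sum (f := fun k => a k t) (fun i _ => P.nonneg i t ht)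
    (Finset.self_mem_range_succ k)).trans (hB (k + 1))

/-- If the estimate stays below `θ + kc` on a segment, the errors are summable there. -/
theorem segment_bound_of_lt (P : LearningProcess T s h kc kθ θ C a g e θhat)
    {j : ℕ} (hj : j < s)
    (hlt : ∀ k, ∀ t ∈ Ioc (h j) (h (j + 1)), θhat k t < θ + kc) :
    ∃ B, ∀ t ∈ Ioc (h j) (h (j + 1)),
      (∀ K, ∑ k ∈ Finset.range K, a k t ≤ B) ∧ ∀ k, θhat k t ≤ B := by
  obtain ⟨A, hA0, hA⟩ := P.exists_error_bound 0
  have hk := P.kθ_pos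
  have hθ := P.θ_nonneg
  have hkc := P.kc_pos
  refine ⟨max ((θ + kc) / kθ + A) (θ + kc), fun t ht => ⟨fun K => le_max_of_le_left ?_,
    fun k => le_max_of_le_right (hlt k t ht).le⟩⟩
  have htT := P.segment_subset hj ht
  calc ∑ k ∈ Finset.range K, a k t ≤ ∑ k ∈ Finset.range (K + 1), a k t :=
        Finset.sum_le_sum_of_subset_of_nonneg (Finset.range_mono (Nat.le_succ K))
          fun i _ _ => P.nonneg i t htT
    _ = ∑ k ∈ Finset.range K, a (k + 1) t + a 0 t := Finset.sum_range_succ' _ _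
    _ ≤ (θ + kc) / kθ + A := by
        refine add_le_add ?_ (hA t htT)
        rw [le_div_iff₀' hk]
        exact (P.sum_error_le_estimate K htT).trans (hlt K t ht).le

/-- If the estimate has reached `θ + kc` somewhere on a segment, the errors on the segment are
controlled by the errors before it. -/
theorem segment_bound_of_ge (P : LearningProcess T s h kc kθ θ C a g e θhat)
    {j : ℕ} (hj : j < s) {B : ℝ}
    (hB : ∀ t ∈ Icc 0 (h j), ∀ K, ∑ k ∈ Finset.range K, a k t ≤ B) {k₀ : ℕ} {t₀ : ℝ}
    (ht₀ : t₀ ∈ Ioc (h j) (h (j + 1))) (hge : θ + kc ≤ θhat k₀ t₀) :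
    ∃ B, ∀ t ∈ Ioc (h j) (h (j + 1)),
      (∀ K, ∑ k ∈ Finset.range K, a k t ≤ B) ∧ ∀ k, θhat k t ≤ B := by
  have hC := P.C_nonneg
  have hT := P.T_nonneg
  have hk := P.kθ_pos
  have hjT := P.node_mem hj.le
  have hB0 : 0 ≤ B := by simpa using hB 0 ⟨le_rfl, hjT.1⟩ 0
  have hdom : ∀ k, k₀ + 1 ≤ k → ∀ t ∈ Ioc (h j) (h (j + 1)), θ ≤ θhat k t := by
    intro k hk₀ t ht
    have htT := P.segment_subset hj ht
    obtain ⟨M, -, hM⟩ := P.exists_estimate_bound k₀ hj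
    refine le_trans ?_ (P.estimate_mono hk₀ htT)
    rw [P.succ k₀ t htT]
    have h1 := le_proj_of_mem (kc := kc) P.lt hj ht ht₀ hM
    have h2 := mul_nonneg hk.le (P.increment_nonneg (k₀ + 1) htT)
    linarith
  set b : ℕ → ℝ := fun k => C * (a k (h j) + ∫ τ in (0)..(h j), a k τ) with hb
  have hb0 : ∀ k, 0 ≤ b k := fun k =>
    mul_nonneg hC (add_nonneg (P.nonneg k _ hjT) (P.integral_nonneg k hjT))
  have hab : ∀ k, k₀ + 1 ≤ k → ∀ t ∈ Ioc (h j) (h (j + 1)), a k t ≤ b k := fun k hk₀ t ht =>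
    P.saturated k j hj (hdom k hk₀) t ht
  have hbsum : ∀ K, ∑ k ∈ Finset.range K, b k ≤ C * (B + T * B) := by
    intro K
    rw [hb, ← Finset.mul_sum, Finset.sum_add_distrib]
    gcongr
    · exact hB _ ⟨hjT.1, le_rfl⟩ K
    · exact P.sum_integral_le hjT K hB0 fun τ hτ => hB τ hτ K
  choose A hA0 hA using P.exists_error_bound
  set B₁ := ∑ k ∈ Finset.range (k₀ + 1), A k + C * (B + T * B) with hB₁
  have hsum : ∀ t ∈ Ioc (h j) (h (j + 1)), ∀ K, ∑ k ∈ Finset.range K, a k t ≤ B₁ := by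
    intro t ht K
    have htT := P.segment_subset hj ht
    calc ∑ k ∈ Finset.range K, a k t ≤ ∑ k ∈ Finset.range (k₀ + 1 + K), a k t :=
          Finset.sum_le_sum_of_subset_of_nonneg (Finset.range_mono (by omega))
            fun i _ _ => P.nonneg i t htT
      _ = ∑ k ∈ Finset.range (k₀ + 1), a k t + ∑ k ∈ Finset.range K, a (k₀ + 1 + k) t :=
          Finset.sum_range_add _ _ _
      _ ≤ ∑ k ∈ Finset.range (k₀ + 1), A k + ∑ k ∈ Finset.range K, b (k₀ + 1 + k) := by
          gcongr with i _ i _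
          · exact hA i t htT
          · exact hab _ (by omega) t ht
      _ ≤ ∑ k ∈ Finset.range (k₀ + 1), A k + ∑ k ∈ Finset.range (k₀ + 1 + K), b k := by
          gcongr
          rw [Finset.sum_range_add]
          exact le_add_of_nonneg_left (Finset.sum_nonneg fun i _ => hb0 i)
      _ ≤ B₁ := add_le_add le_rfl (hbsum _)
  set B₂ := max B B₁ with hB₂
  have hB₂0 : 0 ≤ B₂ := hB0.trans (le_max_left _ _)
  have herr : ∀ k, ∀ τ ∈ Icc 0 (h (j + 1)), a k τ ≤ B₂ := by
    intro k τ hτ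
    rcases le_or_gt τ (h j) with hle | hgt
    · exact (P.error_le_of_sum_le ⟨hτ.1, hle.trans hjT.2⟩ (hB τ ⟨hτ.1, hle⟩) k).trans
        (le_max_left _ _)
    · exact (P.error_le_of_sum_le (P.segment_subset hj ⟨hgt, hτ.2⟩) (hsum τ ⟨hgt, hτ.2⟩) k).trans
        (le_max_right _ _)
  obtain ⟨M, hM0, hM⟩ := P.exists_estimate_bound (k₀ + 1) hj
  set κ := kθ * (C * (1 + T * B₂)) with hκ
  have hκ0 : 0 ≤ κ := by positivity
  have hest : ∀ n, ∀ t ∈ Ioc (h j) (h (j + 1)),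
      θhat (k₀ + 1 + n) t ≤ M + κ * ∑ i ∈ Finset.range (k₀ + 2 + n), b i := by
    intro n
    induction n with
    | zero =>
      intro t ht
      have := Finset.sum_nonneg fun i (_ : i ∈ Finset.range (k₀ + 2 + 0)) => hb0 i
      exact (hM t ht).trans (le_add_of_nonneg_right (mul_nonneg hκ0 this))
    | succ n ih =>
      intro t ht
      have htT := P.segment_subset hj ht
      rw [← add_assoc, P.succ _ t htT, ← add_assoc, Finset.sum_range_succ, mul_add, ← add_assoc]
      refine add_le_add (proj_le P.lt P.kc_pos hj ht ih) ?_
      have h1 := P.increment_le_of_bound htT (k₀ + 1 + n + 1) hB₂0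
        fun τ hτ => herr _ τ ⟨hτ.1, hτ.2.trans ht.2⟩
      have h2 := hab (k₀ + 2 + n) (by omega) t ht
      have h3 : k₀ + 1 + n + 1 = k₀ + 2 + n := by omega
      rw [h3] at h1 ⊢
      calc kθ * g (k₀ + 2 + n) t ≤ kθ * (C * (1 + T * B₂) * a (k₀ + 2 + n) t) := by gcongr
        _ ≤ kθ * (C * (1 + T * B₂) * b (k₀ + 2 + n)) := by gcongr
        _ = κ * b (k₀ + 2 + n) := by rw [hκ]; ring
  refine ⟨max B₁ (M + κ * (C * (B + T * B))), fun t ht => ⟨fun K => le_max_of_le_left (hsum t ht K),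
    fun k => le_max_of_le_right ?_⟩⟩
  refine (P.estimate_mono (by omega : k ≤ k₀ + 1 + k) (P.segment_subset hj ht)).trans
    ((hest k t ht).trans ?_)
  gcongr
  exact hbsum _

theorem exists_bound_upto (P : LearningProcess T s h kc kθ θ C a g e θhat)
    {j : ℕ} (hj : j ≤ s) :
    ∃ B, (∀ t ∈ Icc 0 (h j), ∀ K, ∑ k ∈ Finset.range K, a k t ≤ B) ∧
      ∀ t ∈ Ioc 0 (h j), ∀ k, θhat k t ≤ B := by
  induction j with
  | zero =>
    refine ⟨0, fun t ht K => ?_, fun t ht => ?_⟩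
    · rw [P.start, Icc_self, mem_singleton_iff] at ht
      simp [ht, P.initial]
    · simp [P.start] at ht
  | succ j ih =>
    obtain ⟨B, hB, hBθ⟩ := ih (by omega)
    have hstep : ∃ B, ∀ t ∈ Ioc (h j) (h (j + 1)),
        (∀ K, ∑ k ∈ Finset.range K, a k t ≤ B) ∧ ∀ k, θhat k t ≤ B := by
      by_cases hlt : ∀ k, ∀ t ∈ Ioc (h j) (h (j + 1)), θhat k t < θ + kc
      · exact P.segment_bound_of_lt hj hlt
      · push Not at hlt
        obtain ⟨k₀, t₀, ht₀, hge⟩ := hlt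
        exact P.segment_bound_of_ge hj hB ht₀ hge
    obtain ⟨B', hB'⟩ := hstep
    refine ⟨max B B', fun t ht K => ?_, fun t ht k => ?_⟩
    · rcases le_or_gt t (h j) with hle | hgt
      · exact le_max_of_le_left (hB t ⟨ht.1, hle⟩ K)
      · exact le_max_of_le_right ((hB' t ⟨hgt, ht.2⟩).1 K)
    · rcases le_or_gt t (h j) with hle | hgt
      · exact le_max_of_le_left (hBθ t ⟨ht.1, hle⟩ k)
      · exact le_max_of_le_right ((hB' t ⟨hgt, ht.2⟩).2 k)

/-- In a learning process the errors are summable over the iterations and the estimates are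
bounded, both uniformly in time. -/
theorem exists_bound (P : LearningProcess T s h kc kθ θ C a g e θhat) :
    ∃ B, 0 ≤ B ∧ ∀ t ∈ Icc 0 T,
      (∀ K, ∑ k ∈ Finset.range K, a k t ≤ B) ∧ ∀ k, |θhat k t| ≤ B := by
  obtain ⟨B, hB, hBθ⟩ := P.exists_bound_upto le_rfl
  rw [P.last] at hB hBθ
  have h0T : (0 : ℝ) ∈ Icc 0 T := ⟨le_rfl, P.T_nonneg⟩
  have hB0 : 0 ≤ B := by simpa using hB 0 h0T 0
  refine ⟨B, hB0, fun t ht => ⟨hB t ht, fun k => ?_⟩⟩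
  rw [abs_of_nonneg (P.estimate_nonneg k ht)]
  rcases ht.1.eq_or_lt with rfl | hpos
  · induction k with
    | zero => rw [P.zero 0 h0T]; exact hB0
    | succ k ih =>
      have hg : g (k + 1) 0 ≤ 0 := by simpa [P.initial] using P.increment_le (k + 1) 0 h0T
      have hi : segIndex s h 0 = 0 + 1 := by
        have := segIndex_initial P.lt P.one_le
        rwa [P.start] at this
      have h1 := proj_le_of_index (kc := kc) P.lt P.kc_pos P.one_le hi ih fun τ hτ =>
        hBθ τ ⟨by simpa [P.start] using hτ.1, (P.segment_subset P.one_le hτ).2⟩ k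
      rw [P.succ k 0 h0T]
      have h2 := mul_nonpos_of_nonneg_of_nonpos P.kθ_pos.le hg
      linarith
  · exact hBθ t ⟨hpos, ht.2⟩ k

/-- The accumulated error of an iteration tends to zero. -/
theorem tendsto_integral (P : LearningProcess T s h kc kθ θ C a g e θhat)
    {t : ℝ} (ht : t ∈ Icc 0 T) :
    Tendsto (fun k => ∫ τ in (0)..t, a k τ) atTop (𝓝 0) := by
  obtain ⟨B, hB0, hB⟩ := P.exists_bound
  refine (summable_of_sum_range_le (c := T * B) (fun k => P.integral_nonneg k ht)
    fun K => ?_).tendsto_atTop_zero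
  exact P.sum_integral_le ht K hB0 fun τ hτ => (hB τ ⟨hτ.1, hτ.2.trans ht.2⟩).1 K

end LearningProcess

end Learning

end DualILC

namespace DualILC

/-! ### Bounds on the gains and on the input -/

section Gains

variable {D : DualQuat} {ωd ωd' : DualVec3} {c : ℝ}

theorem gain_fst_le (hD : IsUnitDual D) (hc : 0 ≤ c) (h1 : ‖ωd.fst‖ ≤ c) (h3 : ‖ωd'.fst‖ ≤ c) :
    ‖(tr D ωd).fst‖ ^ 2 + ‖(tr D ωd').fst‖ + 1 ≤ (2 * c ^ 2 + 2 * c + 1) * (1 + ‖D.snd‖) := by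
  rw [hD.norm_fst_tr, hD.norm_fst_tr]
  have : ‖ωd.fst‖ ^ 2 ≤ c ^ 2 := by gcongr
  have : 0 ≤ (2 * c ^ 2 + 2 * c + 1) * ‖D.snd‖ := by positivity
  nlinarith [sq_nonneg c]

theorem gain_snd_le (hD : IsUnitDual D) (hc : 0 ≤ c) (h1 : ‖ωd.fst‖ ≤ c) (h2 : ‖ωd.snd‖ ≤ c)
    (h3 : ‖ωd'.fst‖ ≤ c) (h4 : ‖ωd'.snd‖ ≤ c) :
    ‖cross (tr D ωd).fst (tr D ωd).snd + (tr D ωd').snd‖ + 1 ≤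
      (2 * c ^ 2 + 2 * c + 1) * (1 + ‖D.snd‖) := by
  have b1 : ‖cross (tr D ωd).fst (tr D ωd).snd‖ ≤ c * (c + 2 * ‖D.snd‖ * c) := by
    refine (norm_cross_le _ _).trans ?_
    rw [hD.norm_fst_tr]
    refine mul_le_mul h1 ((hD.norm_snd_tr_le _).trans ?_) (norm_nonneg _) hc
    gcongr
  have b2 : ‖(tr D ωd').snd‖ ≤ c + 2 * ‖D.snd‖ * c := by
    refine (hD.norm_snd_tr_le _).trans ?_
    gcongr
  have b3 := norm_add_le (cross (tr D ωd).fst (tr D ωd).snd) (tr D ωd').snd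
  nlinarith [sq_nonneg c, norm_nonneg D.snd]

theorem crs_funcOfSgn_le {W u : DualVec3} (hu : IsDualSgnValue u W) (hD : IsUnitDual D)
    (hc : 0 ≤ c) (h1 : ‖ωd.fst‖ ≤ c) (h2 : ‖ωd.snd‖ ≤ c) (h3 : ‖ωd'.fst‖ ≤ c)
    (h4 : ‖ωd'.snd‖ ≤ c) :
    crs W (funcOfSgn u (tr D ωd) (tr D ωd')) ≤
      3 * (2 * c ^ 2 + 2 * c + 1) * (1 + ‖D.snd‖) * speed W := by
  rw [crs_funcOfSgn]
  have hG : 0 ≤ (2 * c ^ 2 + 2 * c + 1) * (1 + ‖D.snd‖) := by positivity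
  have i1 := (norm_nonneg _).trans hu.1.norm_le_inner
  have i2 := (norm_nonneg _).trans hu.2.norm_le_inner
  have k1 := mul_le_mul (gain_fst_le hD hc h1 h3) hu.1.inner_le i1 hG
  have k2 := mul_le_mul (gain_snd_le hD hc h1 h2 h3 h4) hu.2.inner_le i2 hG
  unfold speed
  linarith

theorem norm_control_le {W u : DualVec3} {kp kd θhat R B : ℝ} (hkp : 0 < kp) (hkd : 0 < kd)
    (hu : IsDualSgnValue u W) (hD : IsUnitDual D) (hc : 0 ≤ c) (h1 : ‖ωd.fst‖ ≤ c)
    (h2 : ‖ωd.snd‖ ≤ c) (h3 : ‖ωd'.fst‖ ≤ c) (h4 : ‖ωd'.snd‖ ≤ c) (hDR : ‖D.snd‖ ≤ R)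
    (hθ : |θhat| ≤ B) (hW : speed W ≤ B) :
    ‖(control kp kd θhat D W u ωd ωd').fst‖ ≤
        B * ((2 * c ^ 2 + 2 * c + 1) * (1 + R) * 3) + kd * B + kp * (1 + R) ∧
      ‖(control kp kd θhat D W u ωd ωd').snd‖ ≤
        B * ((2 * c ^ 2 + 2 * c + 1) * (1 + R) * 3) + kd * B + kp * (1 + R) := by
  have hB : 0 ≤ B := (abs_nonneg _).trans hθ
  have hR : 0 ≤ R := (norm_nonneg _).trans hDR
  have hG : (2 * c ^ 2 + 2 * c + 1) * (1 + ‖D.snd‖) ≤ (2 * c ^ 2 + 2 * c + 1) * (1 + R) := by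
    gcongr
  have key : ∀ (γ : ℝ) (v x y : Vec3), 0 ≤ γ → γ ≤ (2 * c ^ 2 + 2 * c + 1) * (1 + R) → ‖v‖ ≤ 3 →
      ‖x‖ ≤ B → ‖y‖ ≤ 1 + R → ‖-(θhat • γ • v) - kd • x - kp • y‖ ≤
        B * ((2 * c ^ 2 + 2 * c + 1) * (1 + R) * 3) + kd * B + kp * (1 + R) := by
    intro γ v x y hγ0 hγ hv hx hy
    refine (norm_sub_le _ _).trans (add_le_add ((norm_sub_le _ _).trans (add_le_add ?_ ?_)) ?_)
    · rw [norm_neg, norm_smul, norm_smul, Real.norm_eq_abs, Real.norm_of_nonneg hγ0]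
      gcongr
    · rw [norm_smul, Real.norm_of_nonneg hkd.le]; gcongr
    · rw [norm_smul, Real.norm_of_nonneg hkp.le]; gcongr
  have hW1 : ‖W.fst‖ ≤ B := by
    unfold speed at hW; linarith [norm_nonneg W.snd]
  have hW2 : ‖W.snd‖ ≤ B := by
    unfold speed at hW; linarith [norm_nonneg W.fst]
  refine ⟨?_, ?_⟩
  · have := key _ u.snd W.snd (red (star D.fst * D.snd)) (by positivity)
      ((gain_snd_le hD hc h1 h2 h3 h4).trans hG) hu.2.norm_le hW2 (by
        refine (norm_red_le _).trans ?_
        rw [norm_mul, Quaternion.norm_star, hD.norm_fst]; linarith)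
    simpa [control, funcOfSgn, exch, dualConj] using this
  · have := key _ u.fst W.fst (red D.fst) (by positivity)
      ((gain_fst_le hD hc h1 h3).trans hG) hu.1.norm_le hW1 (by
        refine (norm_red_le _).trans ?_
        rw [hD.norm_fst]; linarith)
    simpa [control, funcOfSgn, exch, dualConj] using this

end Gains

/-! ### Convergence of poses -/

theorem IsUnitDual.mul_dualConj {q : DualQuat} (hq : IsUnitDual q) : q * dualConj q = 1 := by
  ext1
  · simpa [dualConj] using hq.1
  · simpa [dualConj] using hq.2

theorem norm_positionError {Qd Q : ℍ[ℝ]} (hQd : Qd * star Qd = 1) (hQ : Q * star Q = 1)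
    (Pd P : Vec3) :
    ‖positionError Qd Pd Q P‖ = 2 * ‖(poseError (pose Qd Pd) (pose Q P)).snd‖ := by
  have hu := (isUnitDual_pose hQd Pd).poseError (isUnitDual_pose hQ P)
  set r := star Qd * Q with hr
  have hf : (poseError (pose Qd Pd) (pose Q P)).fst = r := by simp [poseError, dualConj, pose, hr]
  have hrr : r * star r = 1 := by rw [← hf]; exact hu.1
  have hpure : aug (red (star r * aug Pd * r)) = star r * aug Pd * r :=
    aug_red_of_star_eq_neg (by simp [mul_assoc])
  have e : (poseError (pose Qd Pd) (pose Q P)).snd =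
      (1 / 2 : ℝ) • (r * aug (positionError Qd Pd Q P)) := by
    have e' : r * (star r * aug Pd * r) = aug Pd * r := by
      rw [mul_assoc (star r), ← mul_assoc r, hrr, one_mul]
    rw [positionError, ← hr, aug_sub, hpure, mul_sub, e']
    simp [poseError, dualConj, pose, hr, smul_sub, mul_assoc]
    abel
  rw [e, norm_smul, norm_mul, norm_aug, norm_mul_star_self_eq_one hrr]
  norm_num
  ring

theorem tendsto_dualQuat {f : ℕ → DualQuat} {q : DualQuat}
    (h1 : Tendsto (fun k => (f k).fst) atTop (𝓝 q.fst))
    (h2 : Tendsto (fun k => (f k).snd) atTop (𝓝 q.snd)) : Tendsto f atTop (𝓝 q) := by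
  rw [TrivSqZeroExt.nhds_def]
  exact h1.prodMk h2

theorem tendsto_smul_one {f : ℕ → DualQuat} {σ : ℕ → ℝ} (hσ : ∀ k, σ k = 1 ∨ σ k = -1)
    (h1 : Tendsto (fun k => ‖(f k).fst - σ k • (1 : ℍ[ℝ])‖) atTop (𝓝 0))
    (h2 : Tendsto (fun k => ‖(f k).snd‖) atTop (𝓝 0)) :
    Tendsto (fun k => σ k • f k) atTop (𝓝 1) := by
  have hn : ∀ k (x : ℍ[ℝ]), ‖σ k • x‖ = ‖x‖ := fun k x => by
    rcases hσ k with hk | hk <;> simp [hk]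
  have hs : ∀ k, σ k * σ k = 1 := fun k => by rcases hσ k with hk | hk <;> simp [hk]
  refine tendsto_dualQuat ?_ ?_
  · rw [tendsto_iff_norm_sub_tendsto_zero]
    refine h1.congr fun k => ?_
    rw [← hn k, smul_sub, smul_smul, hs, one_smul]
    simp
  · simp only [TrivSqZeroExt.snd_smul, TrivSqZeroExt.snd_one]
    rw [tendsto_zero_iff_norm_tendsto_zero]
    exact h2.congr fun k => (hn k _).symm

end DualILC

theorem theorem1
    -- time horizon and its segments
    (T : ℝ) (s : ℕ) (hs : 1 ≤ s) (h : ℕ → ℝ) (h_zero : h 0 = 0) (h_last : h s = T)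
    (h_lt : ∀ j < s, h j < h (j + 1))
    -- control and learning parameters
    (kp kd kc kθ : ℝ) (hkp : 0 < kp) (hkd : 0 < kd) (hkc : 0 < kc) (hkθ : 0 < kθ)
    -- mass and inertia matrix of the body
    (m : ℝ) (hm : 0 < m) (J : Matrix (Fin 3) (Fin 3) ℝ) (hJ : J.PosDef)
    -- desired motion
    (Qd : ℝ → Quaternion ℝ) (Pd : ℝ → Vec3) (ωd ωd' : ℝ → DualVec3)
    (hQd : ∀ t ∈ Set.Icc 0 T, Qd t * star (Qd t) = 1)
    (hd_kin : Kinematics T (fun t => pose (Qd t) (Pd t)) ωd)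
    (hωd : ∀ t ∈ Set.Icc 0 T, HasDualDerivWithinAt ωd (ωd' t) (Set.Icc 0 T) t)
    (hωd' : ∃ C : ℝ, ∀ t ∈ Set.Icc 0 T, ‖(ωd' t).fst‖ ≤ C ∧ ‖(ωd' t).snd‖ ≤ C)
    -- motion, input, disturbance and estimate in iteration `k`
    (Q : ℕ → ℝ → Quaternion ℝ) (P : ℕ → ℝ → Vec3) (ω f d : ℕ → ℝ → DualVec3)
    (θhat : ℕ → ℝ → ℝ)
    (hQ : ∀ k, ∀ t ∈ Set.Icc 0 T, Q k t * star (Q k t) = 1)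
    (h_kin : ∀ k, Kinematics T (fun t => pose (Q k t) (P k t)) (ω k))
    (h_dyn : ∀ k, Dynamics T m J (ω k) (f k) (d k))
    -- tracking errors
    (δQ : ℕ → ℝ → DualQuat) (δω : ℕ → ℝ → DualVec3)
    (hδQ : ∀ k t, δQ k t = poseError (pose (Qd t) (Pd t)) (pose (Q k t) (P k t)))
    (hδω : ∀ k t, δω k t = velocityError (δQ k t) (ωd t) (ω k t))
    -- initial conditions
    (sg : ℕ → ℝ) (hsg : ∀ k, sg k = 1 ∨ sg k = -1)
    (hδQ_zero : ∀ k, δQ k 0 = sg k • (1 : DualQuat))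
    (hδω_zero : ∀ k, δω k 0 = 0)
    -- bounds on parameters and disturbances
    (βm βJ : ℝ) (βd βs : ℝ → ℝ) (hβm : m ≤ βm)
    (hβJ : ‖Matrix.toEuclideanCLM (𝕜 := ℝ) J‖ ≤ βJ)
    (hβd : ∀ k, ∀ t ∈ Set.Icc 0 T, ‖(d k t).fst‖ ≤ βd t)
    (hβs : ∀ k, ∀ t ∈ Set.Icc 0 T, ‖(d k t).snd‖ ≤ βs t)
    (hβd_bdd : BddAbove (βd '' Set.Icc 0 T)) (hβs_bdd : BddAbove (βs '' Set.Icc 0 T))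
    -- control law; `u k t` is the value taken for the sign of `δω k t`
    (u : ℕ → ℝ → DualVec3)
    (hu : ∀ k, ∀ t ∈ Set.Icc 0 T, IsDualSgnValue (u k t) (δω k t))
    (hf : ∀ k, ∀ t ∈ Set.Icc 0 T,
      f k t = control kp kd (θhat k t) (δQ k t) (δω k t) (u k t) (ωd t) (ωd' t))
    -- learning law
    (hθ_zero : ∀ t ∈ Set.Icc 0 T, θhat 0 t = 0)
    (hθ_succ : ∀ k, ∀ t ∈ Set.Icc 0 T,
      θhat (k + 1) t - proj s h kc (θhat k) t =
        learningIncrement kθ (δQ (k + 1) t) (δω (k + 1) t) (ωd t) (ωd' t)) :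
    -- perfect tracking at every time
    (∀ t ∈ Set.Icc 0 T,
      Filter.Tendsto (fun k => sg k • δQ k t) Filter.atTop (nhds 1) ∧
      Filter.Tendsto (fun k => sg k • pose (Q k t) (P k t)) Filter.atTop
        (nhds (pose (Qd t) (Pd t))) ∧
      Filter.Tendsto (fun k => ‖positionError (Qd t) (Pd t) (Q k t) (P k t)‖)
        Filter.atTop (nhds 0) ∧
      Filter.Tendsto (fun k => ‖red (δQ k t).fst‖) Filter.atTop (nhds 0)) ∧
    -- boundedness, uniform in the time and in the iteration
    (∃ B : ℝ, ∀ k, ∀ t ∈ Set.Icc 0 T,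
      ‖(f k t).fst‖ ≤ B ∧ ‖(f k t).snd‖ ≤ B ∧
      ‖(δQ k t).fst‖ ≤ B ∧ ‖(δQ k t).snd‖ ≤ B ∧
      ‖(δω k t).fst‖ ≤ B ∧ ‖(δω k t).snd‖ ≤ B ∧
      |θhat k t| ≤ B) := by
  have hT : 0 ≤ T := by
    rw [← h_last, ← h_zero]; exact segment_le h_lt (Nat.zero_le s) le_rfl
  have h0T : (0 : ℝ) ∈ Icc 0 T := ⟨le_rfl, hT⟩
  -- error kinematics
  have hD : ∀ k, ∀ t ∈ Icc 0 T, IsUnitDual (δQ k t) := fun k t ht => by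
    rw [hδQ]
    exact (isUnitDual_pose (hQd t ht) _).poseError (isUnitDual_pose (hQ k t ht) _)
  have hkin : ∀ k, Kinematics T (δQ k) (fun t => velocityError (δQ k t) (ωd t) (ω k t)) := by
    intro k
    have := hd_kin.poseError (h_kin k) (fun t ht => isUnitDual_pose (hQd t ht) _)
      (fun t ht => isUnitDual_pose (hQ k t ht) _)
    simpa only [← hδQ] using this
  have hW : ∀ k, δω k = fun t => velocityError (δQ k t) (ωd t) (ω k t) := fun k => funext (hδω k)
  have hkin' : ∀ k, Kinematics T (δQ k) (δω k) := fun k => by rw [hW]; exact hkin k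
  have hAC : ∀ k, DualAbsolutelyContinuous (δω k) T := fun k => by
    rw [hW]
    exact dualAbsolutelyContinuous_velocityError hT (hD k) (hkin k) hωd hωd' (h_dyn k).1
  have hcont : ∀ k, ContinuousOn (fun t => speed (δω k t)) (Icc 0 T) := fun k => by
    have h1 := (hAC k).1.continuousOn
    have h2 := (hAC k).2.continuousOn
    rw [uIcc_of_le hT] at h1 h2
    exact h1.norm.add h2.norm
  have hfst0 : ∀ k, (δQ k 0).fst = sg k • (1 : ℍ[ℝ]) := fun k => by simp [hδQ_zero]
  have hsnd0 : ∀ k, (δQ k 0).snd = 0 := fun k => by simp [hδQ_zero]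
  have hfst : ∀ k, ∀ t ∈ Icc 0 T,
      ‖(δQ k t).fst - sg k • (1 : ℍ[ℝ])‖ ≤ ∫ τ in (0)..t, speed (δω k τ) := fun k t ht => by
    rw [← hfst0]; exact (hkin' k).norm_fst_sub_le (hD k) (hcont k) ht
  have hsnd : ∀ k, ∀ t ∈ Icc 0 T, ‖(δQ k t).snd‖ ≤ ∫ τ in (0)..t, speed (δω k τ) :=
    fun k t ht => (hkin' k).norm_snd_le (hD k) (hsnd0 k) (hcont k) ht
  -- bounds on the desired motion and the disturbances
  obtain ⟨c, hc0, hc1, hc2, hc3, hc4⟩ : ∃ c, 0 ≤ c ∧ (∀ t ∈ Icc 0 T, ‖(ωd t).fst‖ ≤ c) ∧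
      (∀ t ∈ Icc 0 T, ‖(ωd t).snd‖ ≤ c) ∧ (∀ t ∈ Icc 0 T, ‖(ωd' t).fst‖ ≤ c) ∧
      (∀ t ∈ Icc 0 T, ‖(ωd' t).snd‖ ≤ c) := by
    obtain ⟨c₁, hc₁⟩ := isCompact_Icc.exists_bound_of_continuousOn
      (fun t ht => (hωd t ht).1.continuousWithinAt)
    obtain ⟨c₂, hc₂⟩ := isCompact_Icc.exists_bound_of_continuousOn
      (fun t ht => (hωd t ht).2.continuousWithinAt)
    obtain ⟨c₃, hc₃⟩ := hωd'
    refine ⟨max c₁ (max c₂ c₃), ?_, fun t ht => le_max_of_le_left (hc₁ t ht),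
      fun t ht => le_max_of_le_right (le_max_of_le_left (hc₂ t ht)),
      fun t ht => le_max_of_le_right (le_max_of_le_right (hc₃ t ht).1),
      fun t ht => le_max_of_le_right (le_max_of_le_right (hc₃ t ht).2)⟩
    exact le_max_of_le_left ((norm_nonneg _).trans (hc₁ 0 h0T))
  obtain ⟨θ, hmθ, hJθ, hdθ, hsθ⟩ : ∃ θ, m ≤ θ ∧ ‖Matrix.toEuclideanCLM (𝕜 := ℝ) J‖ ≤ θ ∧
      (∀ k, ∀ t ∈ Icc 0 T, ‖(d k t).fst‖ ≤ θ) ∧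
      ∀ k, ∀ t ∈ Icc 0 T, ‖(d k t).snd‖ + 2 * kp ≤ θ := by
    obtain ⟨b₁, hb₁⟩ := hβd_bdd
    obtain ⟨b₂, hb₂⟩ := hβs_bdd
    refine ⟨max (max βm βJ) (max b₁ (b₂ + 2 * kp)),
      le_max_of_le_left (le_max_of_le_left hβm), le_max_of_le_left (le_max_of_le_right hβJ),
      fun k t ht => le_max_of_le_right (le_max_of_le_left ?_),
      fun k t ht => le_max_of_le_right (le_max_of_le_right ?_)⟩
    · exact (hβd k t ht).trans (hb₁ (mem_image_of_mem _ ht))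
    · have := (hβs k t ht).trans (hb₂ (mem_image_of_mem _ ht))
      linarith
  -- the learning process
  obtain ⟨C, hC0, hC⟩ := exists_speed_le_of_energy_le hm hkp hJ
  have hproc : LearningProcess T s h kc kθ θ (max C (3 * (2 * c ^ 2 + 2 * c + 1)))
      (fun k t => speed (δω k t))
      (fun k t => crs (δω k t) (func (δω k t) (tr (δQ k t) (ωd t)) (tr (δQ k t) (ωd' t))))
      (fun k t => ‖(δQ k t).snd‖) θhat :=
    { one_le := hs
      start := h_zero
      last := h_last
      lt := h_lt
      kc_pos := hkc
      kθ_pos := hkθ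
      θ_nonneg := hm.le.trans hmθ
      C_nonneg := le_max_of_le_left hC0
      continuousOn := hcont
      nonneg := fun k t _ => speed_nonneg _
      initial := fun k => by simp [hδω_zero, speed]
      error_le := fun k t _ => speed_le_crs_funcOfSgn (isDualSgnValue_dualSgn _) _ _
      increment_le := fun k t ht => by
        refine (crs_funcOfSgn_le (isDualSgnValue_dualSgn _) (hD k t ht) hc0 (hc1 t ht) (hc2 t ht)
          (hc3 t ht) (hc4 t ht)).trans ?_
        have := speed_nonneg (δω k t)
        gcongr
        exact le_max_right _ _
      accumulated_le := hsnd
      saturated := by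
        intro k j hj hθ t ht
        have hjT : h j ∈ Icc 0 T := by
          refine ⟨?_, ?_⟩
          · rw [← h_zero]; exact segment_le h_lt (Nat.zero_le _) hj.le
          · rw [← h_last]; exact segment_le h_lt hj.le le_rfl
        have htT : t ≤ T := by
          rw [← h_last]; exact ht.2.trans (segment_le h_lt (Nat.succ_le_of_lt hj) le_rfl)
        have hE := energy_le_energy_of_le_estimate hjT.1 ht.1.le htT hm hkp hkd hJ hmθ hJθ
          (hdθ k) (hsθ k) (hD k) (hsg k) (hkin k) hωd hωd' (h_dyn k)
          (fun τ hτ => by rw [← hδω]; exact hu k τ hτ)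
          (fun τ hτ => by rw [← hδω]; exact hf k τ hτ)
          (fun τ hτ => hθ τ ⟨hτ.1, hτ.2.trans ht.2⟩)
        rw [← hδω, ← hδω] at hE
        refine (hC _ _ _ _ _ _ hE (hsnd k _ hjT) (hfst k _ hjT)).trans ?_
        have h1 := speed_nonneg (δω k (h j))
        have h2 := (norm_nonneg _).trans (hsnd k _ hjT)
        gcongr
        exact le_max_left _ _
      zero := hθ_zero
      succ := fun k t ht => by
        rw [← sub_eq_iff_eq_add', hθ_succ k t ht, learningIncrement] }
  refine ⟨fun t ht => ?_, ?_⟩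
  · have hint := hproc.tendsto_integral ht
    have hlim1 : Tendsto (fun k => ‖(δQ k t).fst - sg k • (1 : ℍ[ℝ])‖) atTop (𝓝 0) :=
      squeeze_zero (fun _ => norm_nonneg _) (fun k => hfst k t ht) hint
    have hlim2 : Tendsto (fun k => ‖(δQ k t).snd‖) atTop (𝓝 0) :=
      squeeze_zero (fun _ => norm_nonneg _) (fun k => hsnd k t ht) hint
    have hlim := tendsto_smul_one hsg hlim1 hlim2
    refine ⟨hlim, ?_, ?_, ?_⟩
    · have hmul := hlim.const_mul (pose (Qd t) (Pd t))
      rw [mul_one] at hmul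
      refine hmul.congr fun k => ?_
      rw [mul_smul_comm, hδQ, poseError, ← mul_assoc,
        (isUnitDual_pose (hQd t ht) (Pd t)).mul_dualConj, one_mul]
    · have := hlim2.const_mul 2
      rw [mul_zero] at this
      refine this.congr fun k => ?_
      rw [norm_positionError (hQd t ht) (hQ k t ht), hδQ]
    · refine squeeze_zero (fun _ => norm_nonneg _) (fun k => ?_) hlim1
      have hred : red (δQ k t).fst = red ((δQ k t).fst - sg k • (1 : ℍ[ℝ])) := by
        ext i; fin_cases i <;> simp
      rw [hred]
      exact norm_red_le _
  · obtain ⟨B, hB0, hB⟩ := hproc.exists_bound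
    have hspeed : ∀ k, ∀ t ∈ Icc 0 T, speed (δω k t) ≤ B := fun k t ht =>
      hproc.error_le_of_sum_le ht (hB t ht).1 k
    have hsndB : ∀ k, ∀ t ∈ Icc 0 T, ‖(δQ k t).snd‖ ≤ T * B := fun k t ht =>
      (hsnd k t ht).trans (hproc.integral_le ht k hB0 fun τ hτ =>
        hspeed k τ ⟨hτ.1, hτ.2.trans ht.2⟩)
    set F := B * ((2 * c ^ 2 + 2 * c + 1) * (1 + T * B) * 3) + kd * B + kp * (1 + T * B) with hF
    have hF0 : 0 ≤ F := by positivity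
    have hTB : 0 ≤ T * B := by positivity
    refine ⟨F + 1 + T * B + B, fun k t ht => ?_⟩
    have hctl := norm_control_le hkp hkd (hu k t ht) (hD k t ht) hc0 (hc1 t ht) (hc2 t ht)
      (hc3 t ht) (hc4 t ht) (hsndB k t ht) ((hB t ht).2 k) (hspeed k t ht)
    rw [← hf k t ht, ← hF] at hctl
    have h1 := (hD k t ht).norm_fst
    have h2 := hsndB k t ht
    have h3 := hspeed k t ht
    have h4 := (hB t ht).2 k
    unfold speed at h3
    have h5 := norm_nonneg (δω k t).fst
    have h6 := norm_nonneg (δω k t).snd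
    exact ⟨by linarith [hctl.1], by linarith [hctl.2], by linarith, by linarith, by linarith,
      by linarith, by linarith⟩
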